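/- Let $R=\bigoplus_k R_k$ be a commutative $\mathbb{Z}$-graded ring concentrated in even degrees, and let $d$ be an even integer. Let $A$ be a Moore algebra of degree $d$ over $R$, that is, a strictly unital $A_\infty$-algebra over $R$ whose underlying complex is a two-cell complex $\Sigma^dR\to R$ (so $A$ is free on the unit $1$ in degree $0$ and a generator $y$ in degree $d+1$, and $m_1$ is the differential of the complex). Let $u(t)=\sum_{i\ge1}u_it^i$, with $m_i[y|\dots|y]=u_i[1]$, be its characteristic series, and assume that $u_1$ is not a zero divisor in $R$. Let $HH^*(A,A)$ be the Hochschild cohomology of $A$, i.e. the cohomology of the graded Lie algebra of all coderivations of the bar construction $T\Sigma A$ with the differential $\xi\mapsto[\xi,m]$. Write $u'(t)$ for the derivative of $u(t)$, and give $t$ the degree $-(d+2)$. Then there is an isomorphism of $R$-modules $$HH^*(A,A)\;\cong\;R[[t]]/(u'(t)),$$ which carries, for every $k\in\mathbb{Z}$, the classes of cocycles that are homogeneous of degree $k$ onto the classes of power series that are homogeneous of degree $k-1$. This holds in both possible readings: with graded objects on both sides (direct sums of the homogeneous parts, so that $R[[t]]$ is the graded power series ring), and with all $R$-linear coderivations of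 $T\Sigma A$ on the left and the ring of all power series $R[[t]]$ on the right. -/

import Mathlib

open scoped TensorProduct PowerSeries

/-- A `ℤ`-grading of a ring is even if it is concentrated in even degrees. -/
def IsEvenlyGraded {R : Type*} [CommRing R] (𝒜 : ℤ → AddSubgroup R) : Prop :=
  ∀ k : ℤ, Odd k → 𝒜 k = ⊥

namespace Bar

/-- The tensor coalgebra `TΣA = R ⊕ ΣA ⊕ (ΣA)^{⊗2} ⊕ …` of the suspension of the free `R`-module `A`
with basis `ι`: it is free on the words `[a₁|…|aₙ]` in the letters `ι`. -/
def T (R : Type*) [CommRing R] (ι : Type*) := List ι →₀ R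

noncomputable instance (R : Type*) [CommRing R] (ι : Type*) : AddCommGroup (T R ι) :=
  inferInstanceAs (AddCommGroup (List ι →₀ R))

noncomputable instance (R : Type*) [CommRing R] (ι : Type*) : Module R (T R ι) :=
  inferInstanceAs (Module R (List ι →₀ R))

/-- The basis of `TΣA` given by the words. -/
noncomputable def wordBasis (R : Type*) [CommRing R] (ι : Type*) : Module.Basis (List ι) R (T R ι) :=
  Module.Basis.ofRepr (LinearEquiv.refl R (List ι →₀ R))

/-- The degree `∑ (|aᵢ| + 1)` of the word `[a₁|…|aₙ]` in `TΣA`, where `deg` is the degree in `A`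
of the basis elements. -/
def wordDeg {ι : Type*} (deg : ι → ℤ) (w : List ι) : ℤ :=
  (w.map fun a => deg a + 1).sum

section

variable (R : Type*) [CommRing R] {ι : Type*} (deg : ι → ℤ)

/-- The word `[a₁|…|aₙ]` as an element of `TΣA`. -/
noncomputable def word (w : List ι) : T R ι := wordBasis R ι w

/-- Deconcatenation: `Δ[a₁|…|aₙ] = ∑ᵢ [a₁|…|aᵢ] ⊗ [aᵢ₊₁|…|aₙ]`, `0 ≤ i ≤ n`. -/
noncomputable def comul : T R ι →ₗ[R] T R ι ⊗[R] T R ι :=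
  (wordBasis R ι).constr R fun w : List ι =>
    ∑ i ∈ Finset.range (w.length + 1), word R (w.take i) ⊗ₜ[R] word R (w.drop i)

open Classical in
/-- The projection of `TΣA` to the span of the words of even degree. -/
noncomputable def evenPart : Module.End R (T R ι) :=
  (wordBasis R ι).constr R fun w : List ι =>
    if Even (wordDeg deg w) then word R w else 0

open Classical in
/-- The projection of `TΣA` to the span of the words of odd degree. -/
noncomputable def oddPart : Module.End R (T R ι) :=
  (wordBasis R ι).constr R fun w : List ι =>
    if Odd (wordDeg deg w) then word R w else 0

/-- The map `x ↦ (-1)^{|x|} x` of `TΣA`. -/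
noncomputable def sgn : Module.End R (T R ι) := evenPart R deg - oddPart R deg

end

variable {R : Type*} [CommRing R] {ι : Type*}

/-- The conjugate of `ξ` by `x ↦ (-1)^{|x|} x`. As `R` is evenly graded, this is the `R`-linear map
with `ξ ↦ (-1)^{|ξ|} ξ` for homogeneous `ξ`. -/
noncomputable def twist (deg : ι → ℤ) :
    Module.End R (T R ι) →ₗ[R] Module.End R (T R ι) :=
  LinearMap.mulLeft R (sgn R deg) ∘ₗ LinearMap.mulRight R (sgn R deg)

/-- The coderivations of `TΣA`, the `R`-linear maps with `Δ ξ = (ξ ⊗ 1 + 1 ⊗ ξ) Δ`. By the sign rule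
`(1 ⊗ ξ)(p ⊗ q) = (-1)^{|ξ||p|} p ⊗ ξ q`, so `1 ⊗ ξ` is the sum of `ξ` on the part where `p` has
even degree and of the twist of `ξ` on the part where `p` has odd degree. Sums of coderivations of
different degrees are allowed. -/
noncomputable def coder (deg : ι → ℤ) : Submodule R (Module.End R (T R ι)) where
  carrier := {ξ | comul R ∘ₗ ξ =
    (TensorProduct.map ξ LinearMap.id + TensorProduct.map (evenPart R deg) ξ
      + TensorProduct.map (oddPart R deg) (twist deg ξ)) ∘ₗ comul R}
  add_mem' := by
    intro a b ha hb
    simp only [Set.mem_ofPred_eq] at ha hb ⊢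
    rw [LinearMap.comp_add, ha, hb, ← LinearMap.add_comp, map_add, TensorProduct.map_add_left,
      TensorProduct.map_add_right, TensorProduct.map_add_right]
    congr 1
    abel
  zero_mem' := by
    simp
  smul_mem' := by
    intro c a ha
    simp only [Set.mem_ofPred_eq] at ha ⊢
    rw [LinearMap.comp_smul, ha, ← LinearMap.smul_comp, map_smul, TensorProduct.map_smul_left,
      TensorProduct.map_smul_right, TensorProduct.map_smul_right, smul_add, smul_add]

/-- `ξ` is homogeneous of degree `k`: it raises degrees by `k`. -/
def IsHomogeneous (𝒜 : ℤ → AddSubgroup R) (deg : ι → ℤ) (k : ℤ)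
    (ξ : Module.End R (T R ι)) : Prop :=
  ∀ w v : List ι, (wordBasis R ι).repr (ξ (word R w)) v ∈ 𝒜 (wordDeg deg w + k - wordDeg deg v)

/-- The direct sum over all degrees `k` of the coderivations that are homogeneous of degree `k`. -/
noncomputable def gradedCoder (𝒜 : ℤ → AddSubgroup R) (deg : ι → ℤ) :
    Submodule R (Module.End R (T R ι)) :=
  Submodule.span R {ξ | ξ ∈ coder deg ∧ ∃ k : ℤ, IsHomogeneous 𝒜 deg k ξ}

/-- The coefficient of `[b]` in `ξₙ[a₁|…|aₙ]`, where `ξₙ : (ΣA)^{⊗n} → ΣA` is the `n`-th component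
of `ξ` and `w = [a₁|…|aₙ]`. -/
noncomputable def component (ξ : Module.End R (T R ι)) (w : List ι) (b : ι) : R :=
  (wordBasis R ι).repr (ξ (word R w)) [b]

end Bar

open Bar

/-- An `A_∞`-structure on the free graded `R`-module `A` with homogeneous basis `ι`. -/
structure AInfinityAlgebra {R : Type*} [CommRing R] (𝒜 : ℤ → AddSubgroup R)
    {ι : Type*} (deg : ι → ℤ) where
  m : Module.End R (T R ι)
  mem_coder : m ∈ coder deg
  homogeneous : IsHomogeneous 𝒜 deg (-1) m
  sq_zero : m ∘ₗ m = 0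
  map_empty : m (word R []) = 0

namespace AInfinityAlgebra

variable {R : Type*} [CommRing R] {𝒜 : ℤ → AddSubgroup R} {ι : Type*} {deg : ι → ℤ}

open Classical in
/-- The basis element `e` is a strict unit: `|e| = 0`, `m₂[e|a] = [a] = (-1)^{|a|} m₂[a|e]`, and for
`n ≠ 2` the component `mₙ` vanishes as soon as one of its arguments is `e`. -/
structure IsStrictUnit (A : AInfinityAlgebra 𝒜 deg) (e : ι) : Prop where
  deg_eq : deg e = 0
  left_unit : ∀ a b : ι, component A.m [e, a] b = if b = a then 1 else 0
  right_unit : ∀ a b : ι,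
    component A.m [a, e] b = if b = a then (((deg a).negOnePow : ℤ) : R) else 0
  vanish : ∀ w : List ι, w.length ≠ 2 → e ∈ w → ∀ b : ι, component A.m w b = 0

/-- The Hochschild differential `ξ ↦ [ξ, m] = ξ m - (-1)^{|ξ|} m ξ`. -/
noncomputable def hochschildD (A : AInfinityAlgebra 𝒜 deg) :
    Module.End R (T R ι) →ₗ[R] Module.End R (T R ι) :=
  LinearMap.mulRight R A.m - LinearMap.mulLeft R A.m ∘ₗ twist deg

/-- The cocycles in the subcomplex `C`. -/
noncomputable def cocycles (A : AInfinityAlgebra 𝒜 deg)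
    (C : Submodule R (Module.End R (T R ι))) : Submodule R (Module.End R (T R ι)) :=
  C ⊓ LinearMap.ker A.hochschildD

/-- The cohomology (cocycles modulo coboundaries) of a complex `C` of coderivations with the
Hochschild differential. -/
abbrev Cohomology (A : AInfinityAlgebra 𝒜 deg) (C : Submodule R (Module.End R (T R ι))) :=
  A.cocycles C ⧸ (C.map A.hochschildD).submoduleOf (A.cocycles C)

/-- The part of degree `k` of the cohomology: the classes of the cocycles of degree `k`. -/
def cohomologyDeg (A : AInfinityAlgebra 𝒜 deg) (C : Submodule R (Module.End R (T R ι))) (k : ℤ) :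
    Set (A.Cohomology C) :=
  {x | ∃ z : A.cocycles C, IsHomogeneous 𝒜 deg k (z : Module.End R (T R ι)) ∧
    Submodule.Quotient.mk z = x}

/-- The Hochschild cohomology `HH^*(A,A)` as a graded `R`-module, the direct sum of its
homogeneous parts: the cohomology of the graded Lie algebra of coderivations of `TΣA`. -/
abbrev HH (A : AInfinityAlgebra 𝒜 deg) := A.Cohomology (gradedCoder 𝒜 deg)

/-- The Hochschild cohomology computed from all `R`-linear coderivations of `TΣA`, including those
with infinitely many homogeneous components. -/
abbrev HHTot (A : AInfinityAlgebra 𝒜 deg) := A.Cohomology (coder deg)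

end AInfinityAlgebra

/-- The basis `1, y` of the complex `Σ^d R → R`. -/
inductive MooreGen
  | one
  | y

/-- `|1| = 0` and `|y| = d + 1`. -/
def MooreGen.deg (d : ℤ) : MooreGen → ℤ
  | one => 0
  | y => d + 1

/-- A Moore algebra of degree `d`: a unital `A_∞`-structure on the two-cell complex `Σ^d R → R`
with unit the generator `1`. The differential of the complex is the component `m₁`. -/
structure MooreAlgebra {R : Type*} [CommRing R] (𝒜 : ℤ → AddSubgroup R) (d : ℤ)
    extends AInfinityAlgebra 𝒜 (MooreGen.deg d) where
  unital : toAInfinityAlgebra.IsStrictUnit MooreGen.one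

/-- The characteristic series `u(t) = ∑ uᵢ tⁱ` of an even Moore algebra, `mᵢ[y|…|y] = uᵢ [1]`. The
constant coefficient is `0`, because `m` vanishes on the empty word. -/
noncomputable def MooreAlgebra.charSeries {R : Type*} [CommRing R] {𝒜 : ℤ → AddSubgroup R} {d : ℤ}
    (A : MooreAlgebra 𝒜 d) : R⟦X⟧ :=
  PowerSeries.mk fun i => component A.m (List.replicate i MooreGen.y) MooreGen.one

namespace GradedSeries

variable {R : Type*} [CommRing R]

/-- The power series in `t` that are homogeneous of degree `k`, where `|t| = -(d + 2)`. -/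
def IsHomogeneous (𝒜 : ℤ → AddSubgroup R) (d k : ℤ) (f : R⟦X⟧) : Prop :=
  ∀ n : ℕ, PowerSeries.coeff n f ∈ 𝒜 (k + n * (d + 2))

/-- The graded power series ring `R[[t]]`, the direct sum of its homogeneous parts. -/
noncomputable def ring (𝒜 : ℤ → AddSubgroup R) (d : ℤ) : Submodule R R⟦X⟧ :=
  Submodule.span R {f | ∃ k : ℤ, IsHomogeneous 𝒜 d k f}

/-- The quotient of the graded power series ring by the multiples of `g`. -/
abbrev Quot (𝒜 : ℤ → AddSubgroup R) (d : ℤ) (g : R⟦X⟧) :=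
  ring 𝒜 d ⧸ ((ring 𝒜 d).map (LinearMap.mulLeft R g)).submoduleOf (ring 𝒜 d)

/-- The part of degree `k` of the quotient. -/
def quotDeg (𝒜 : ℤ → AddSubgroup R) (d : ℤ) (g : R⟦X⟧) (k : ℤ) : Set (Quot 𝒜 d g) :=
  {x | ∃ f : ring 𝒜 d, IsHomogeneous 𝒜 d k (f : R⟦X⟧) ∧ Submodule.Quotient.mk f = x}

end GradedSeries

/-! A coderivation of `TΣA` is the same as the family of its components, and these are arbitrary
(`eq_of_component_eq`, `component_cofree`). For a Moore algebra, parity and strict unitality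
determine `m` up to the series u: words in y alone go to multiples uᵢ [1], and all else is
multiplication by the unit. The Hochschild differential D therefore has an explicit form on
components (`component_hochschildD_one`, `component_hochschildD_y`).

Call a cochain normalized if it vanishes as soon as one argument is [1]. It is then a pair of power
series, f for the output [1] and g for the output [y], and D sends (f, g) to (-u'g, 0)
(`differential_of_isNormalized`): an output [y] can be inserted at i places of mᵢ[y|…|y], which
produces the derivative, and an output [1] only meets the commutator of the unit with y, which is
zero. The constant term of u' is u₁, so u' is not a zero divisor. Hence normalized cocycles have g =
0, and the coboundaries of normalized cochains are the multiples of u'.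

It remains to see that normalized cochains compute the cohomology. The leading part of D is
`contract`, the product of two adjacent units. Doubling the first unit is a contracting homotopy h
for it at the words that contain [1] (`contract_doubleUnit`). The other parts of D raise a
filtration by the number of letters y, so that φ ↦ φ - D h φ improves φ by one step whenever Dφ is
normalized (`filtered_step`). At each word only finitely many steps matter, so the infinite
iteration makes sense, and it changes φ by a coboundary (`isNormalized_sub_normalizer`). Applied to
cocycles this shows that every class is given by a series; applied to cochains with normalized
coboundary it shows that a series is a coboundary only if u' divides it.

The construction is linear and respects degrees, so it works in both readings
(`Compatible.exists_equiv`). The shift of degrees by 1 is the degree of [1] in `TΣA`. -/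

namespace Bar

/-- The sign `(-1)^n` in `R`. -/
def sign (R : Type*) [CommRing R] (n : ℤ) : R := ((n.negOnePow : ℤ) : R)

/-! ### Signs, degrees of words and coefficients -/

section Sign

variable {R : Type*} [CommRing R]

theorem sign_add (m n : ℤ) : sign R (m + n) = sign R m * sign R n := by
  simp [sign, Int.negOnePow_add]

theorem sign_even {n : ℤ} (h : Even n) : sign R n = 1 := by
  simp [sign, Int.negOnePow_even n h]

theorem sign_odd {n : ℤ} (h : Odd n) : sign R n = -1 := by
  simp [sign, Int.negOnePow_odd n h]

@[simp] theorem sign_zero : sign R 0 = 1 := sign_even (by simp)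

@[simp] theorem sign_mul_self (n : ℤ) : sign R n * sign R n = 1 := by
  rw [← sign_add]; exact sign_even ⟨n, rfl⟩

theorem sign_congr {m n : ℤ} (h : Even (m - n)) : sign R m = sign R n := by
  have : m = (m - n) + n := by ring
  rw [this, sign_add, sign_even h, one_mul]

theorem sign_mul_mem (𝒜 : ℤ → AddSubgroup R) {k : ℤ} (n : ℤ) {x : R} (hx : x ∈ 𝒜 k) :
    sign R n * x ∈ 𝒜 k := by
  rcases Int.even_or_odd n with h | h
  · simpa [sign_even h] using hx
  · simpa [sign_odd h] using hx

end Sign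

section WordDeg

variable {ι : Type*} (deg : ι → ℤ)

@[simp] theorem wordDeg_nil : wordDeg deg [] = 0 := rfl

@[simp] theorem wordDeg_cons (a : ι) (w : List ι) :
    wordDeg deg (a :: w) = deg a + 1 + wordDeg deg w := by
  simp [wordDeg]

@[simp] theorem wordDeg_append (v w : List ι) :
    wordDeg deg (v ++ w) = wordDeg deg v + wordDeg deg w := by
  simp [wordDeg]

end WordDeg

section Coef

variable {R : Type*} [CommRing R] {ι : Type*}

/-- The coefficient of the word `v`. -/
noncomputable def coef (v : List ι) : T R ι →ₗ[R] R := (wordBasis R ι).coord v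

theorem repr_eq_coef (x : T R ι) (v : List ι) : (wordBasis R ι).repr x v = coef v x := rfl

open Classical in
@[simp] theorem coef_word (v w : List ι) : coef v (word R w) = if w = v then 1 else 0 := by
  simp [coef, word, Finsupp.single_apply]

theorem ext_coef {x y : T R ι} (h : ∀ v, coef v x = coef v y) : x = y :=
  (wordBasis R ι).ext_elem h

theorem ext_word {M : Type*} [AddCommMonoid M] [Module R M] {f g : T R ι →ₗ[R] M}
    (h : ∀ w, f (word R w) = g (word R w)) : f = g :=
  (wordBasis R ι).ext h

/-- The linear functional with prescribed values on the words. -/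
noncomputable def functional : (List ι → R) →ₗ[R] T R ι →ₗ[R] R :=
  ((wordBasis R ι).constr R).toLinearMap

@[simp] theorem functional_word (φ : List ι → R) (w : List ι) :
    functional φ (word R w) = φ w := by
  simp [functional, word, Module.Basis.constr_basis]

/-- The bilinear coefficient of `v ⊗ v'`. -/
noncomputable def coefTensor (v v' : List ι) : T R ι ⊗[R] T R ι →ₗ[R] R :=
  LinearMap.mul' R R ∘ₗ TensorProduct.map (coef v) (coef v')

@[simp] theorem coefTensor_tmul (v v' : List ι) (x y : T R ι) :
    coefTensor v v' (x ⊗ₜ y) = coef v x * coef v' y := by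
  simp [coefTensor]

theorem ext_coefTensor {x y : T R ι ⊗[R] T R ι}
    (h : ∀ v v', coefTensor v v' x = coefTensor v v' y) : x = y := by
  have key : ∀ (v v' : List ι) (z : T R ι ⊗[R] T R ι),
      ((wordBasis R ι).tensorProduct (wordBasis R ι)).repr z (v, v') = coefTensor v v' z := by
    intro v v' z
    induction z with
    | zero => simp
    | add a b ha hb => simp [ha, hb]
    | tmul a b => simp [Module.Basis.tensorProduct_repr_tmul_apply, repr_eq_coef, mul_comm]
  refine ((wordBasis R ι).tensorProduct (wordBasis R ι)).ext_elem ?_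
  rintro ⟨v, v'⟩
  rw [key, key, h]

theorem comul_word (w : List ι) : comul R (word R w) =
    ∑ i ∈ Finset.range (w.length + 1), word R (w.take i) ⊗ₜ[R] word R (w.drop i) := by
  conv_lhs => rw [comul, word, Module.Basis.constr_basis]

end Coef

/-! ### Stripping words at either end, and the dual of deconcatenation -/

section Quotients

variable {R : Type*} [CommRing R] {ι : Type*}

open Classical in
/-- `F p` at the word `w = p v`, and `0` at the words that do not end in `v`. -/
noncomputable def rightStrip (v : List ι) (F : List ι → R) (w : List ι) : R :=
  if v <:+ w then F (w.take (w.length - v.length)) else 0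

open Classical in
/-- `F q` at the word `w = v q`, and `0` at the words that do not begin with `v`. -/
noncomputable def leftStrip (v : List ι) (F : List ι → R) (w : List ι) : R :=
  if v <+: w then F (w.drop v.length) else 0

@[simp] theorem rightStrip_append (v p : List ι) (F : List ι → R) :
    rightStrip v F (p ++ v) = F p := by
  simp [rightStrip]

@[simp] theorem leftStrip_append (v q : List ι) (F : List ι → R) :
    leftStrip v F (v ++ q) = F q := by
  simp [leftStrip]

theorem rightStrip_of_not {v w : List ι} (F : List ι → R) (h : ∀ p, w ≠ p ++ v) :
    rightStrip v F w = 0 := by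
  rw [rightStrip, if_neg]
  rintro ⟨p, rfl⟩
  exact h p rfl

theorem leftStrip_of_not {v w : List ι} (F : List ι → R) (h : ∀ q, w ≠ v ++ q) :
    leftStrip v F w = 0 := by
  rw [leftStrip, if_neg]
  rintro ⟨p, rfl⟩
  exact h p rfl

theorem rightStrip_mul (v : List ι) (c : R) (F : List ι → R) (w : List ι) :
    rightStrip v (fun p => c * F p) w = c * rightStrip v F w := by
  simp [rightStrip]

theorem leftStrip_mul (v : List ι) (c : R) (F : List ι → R) (w : List ι) :
    leftStrip v (fun p => c * F p) w = c * leftStrip v F w := by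
  simp [leftStrip]

@[simp] theorem rightStrip_nil (F : List ι → R) (w : List ι) : rightStrip [] F w = F w := by
  simp [rightStrip]

@[simp] theorem leftStrip_nil (F : List ι → R) (w : List ι) : leftStrip [] F w = F w := by
  simp [leftStrip]

@[simp] theorem leftStrip_singleton_nil (a : ι) (F : List ι → R) : leftStrip [a] F [] = 0 := by
  simp [leftStrip]

open Classical in
@[simp] theorem leftStrip_singleton_cons (a b : ι) (F : List ι → R) (w : List ι) :
    leftStrip [a] F (b :: w) = if b = a then F w else 0 := by
  simp [leftStrip, eq_comm]

@[simp] theorem rightStrip_singleton_nil (a : ι) (F : List ι → R) : rightStrip [a] F [] = 0 := by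
  simp [rightStrip]

open Classical in
@[simp] theorem rightStrip_singleton_singleton (a b : ι) (F : List ι → R) :
    rightStrip [a] F [b] = if b = a then F [] else 0 := by
  by_cases h : b = a
  · subst h; simp [rightStrip]
  · rw [if_neg h, rightStrip_of_not]
    intro p hp
    have := congrArg List.getLast? hp
    simp at this
    exact h this

theorem rightStrip_singleton_cons_cons (a b c : ι) (F : List ι → R) (w : List ι) :
    rightStrip [a] F (b :: c :: w) = rightStrip [a] (fun p => F (b :: p)) (c :: w) := by
  by_cases h : ∃ p, c :: w = p ++ [a]
  · obtain ⟨p, hp⟩ := h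
    rw [hp, ← List.cons_append, rightStrip_append, rightStrip_append]
  · push Not at h
    rw [rightStrip_of_not _ h, rightStrip_of_not]
    rintro (_ | ⟨e, p⟩) hp
    · simp at hp
    · simp only [List.cons_append, List.cons.injEq] at hp
      exact h p hp.2

open Classical in
theorem sum_take_mul (v w : List ι) (F : List ι → R) :
    ∑ i ∈ Finset.range (w.length + 1), F (w.take i) * (if w.drop i = v then 1 else 0) =
      rightStrip v F w := by
  by_cases h : v <:+ w
  · obtain ⟨p, rfl⟩ := h
    rw [rightStrip_append, Finset.sum_eq_single p.length]
    · simp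
    · intro i hi hne
      rw [if_neg, mul_zero]
      intro h
      have := congrArg List.length h
      simp at this hi
      omega
    · simp
  · rw [rightStrip, if_neg h]
    refine Finset.sum_eq_zero fun i _ => ?_
    rw [if_neg, mul_zero]
    rintro rfl
    exact h (List.drop_suffix i w)

open Classical in
theorem sum_drop_mul (v w : List ι) (F : List ι → R) :
    ∑ i ∈ Finset.range (w.length + 1), (if w.take i = v then 1 else 0) * F (w.drop i) =
      leftStrip v F w := by
  by_cases h : v <+: w
  · obtain ⟨p, rfl⟩ := h
    rw [leftStrip_append, Finset.sum_eq_single v.length]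
    · simp
    · intro i hi hne
      rw [if_neg, zero_mul]
      intro h
      have := congrArg List.length h
      simp at this hi
      omega
    · simp
  · rw [leftStrip, if_neg h]
    refine Finset.sum_eq_zero fun i _ => ?_
    rw [if_neg, zero_mul]
    rintro rfl
    exact h (List.take_prefix i w)

/-- Concatenation is dual to deconcatenation. This turns identities in the tensor square into
identities between coefficients of words. -/
theorem coefTensor_comul (v v' : List ι) (x : T R ι) :
    coefTensor v v' (comul R x) = coef (v ++ v') x := by
  classical
  suffices h : coefTensor v v' ∘ₗ comul R = coef (R := R) (v ++ v') from LinearMap.congr_fun h x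
  refine ext_word fun w => ?_
  rw [LinearMap.comp_apply, comul_word, map_sum]
  simp only [coefTensor_tmul, coef_word]
  rw [sum_take_mul v' w (fun p => if p = v then 1 else 0)]
  by_cases h : ∃ p, w = p ++ v'
  · obtain ⟨p, rfl⟩ := h
    simp
  · push Not at h
    rw [rightStrip_of_not _ h, if_neg (h v)]

end Quotients

/-! ### Coderivations in terms of coefficients -/

section Coderivations

variable {R : Type*} [CommRing R] {ι : Type*} {deg : ι → ℤ}

theorem evenPart_word (w : List ι) :
    evenPart R deg (word R w) = if Even (wordDeg deg w) then word R w else 0 := by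
  conv_lhs => rw [evenPart, word, Module.Basis.constr_basis]

theorem oddPart_word (w : List ι) :
    oddPart R deg (word R w) = if Odd (wordDeg deg w) then word R w else 0 := by
  conv_lhs => rw [oddPart, word, Module.Basis.constr_basis]

theorem sgn_word (w : List ι) : sgn R deg (word R w) = sign R (wordDeg deg w) • word R w := by
  rw [sgn, LinearMap.sub_apply, evenPart_word, oddPart_word]
  rcases Int.even_or_odd (wordDeg deg w) with h | h
  · rw [if_pos h, if_neg (by simpa using h), sign_even h]; simp
  · rw [if_neg (by simpa using h), if_pos h, sign_odd h]; simp

theorem coef_sgn (v : List ι) (x : T R ι) :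
    coef v (sgn R deg x) = sign R (wordDeg deg v) * coef v x := by
  classical
  suffices h : coef v ∘ₗ sgn R deg = sign R (wordDeg deg v) • coef (R := R) v from
    LinearMap.congr_fun h x
  refine ext_word fun w => ?_
  simp only [LinearMap.comp_apply, sgn_word, map_smul, LinearMap.smul_apply, coef_word, smul_eq_mul]
  split_ifs with h
  · rw [h]
  · simp

theorem twist_apply (ξ : Module.End R (T R ι)) (x : T R ι) :
    twist deg ξ x = sgn R deg (ξ (sgn R deg x)) := by
  simp [twist]

theorem coef_twist_word (ξ : Module.End R (T R ι)) (v w : List ι) :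
    coef v (twist deg ξ (word R w)) =
      sign R (wordDeg deg v) * sign R (wordDeg deg w) * coef v (ξ (word R w)) := by
  rw [twist_apply, coef_sgn, sgn_word, map_smul, map_smul, smul_eq_mul, mul_assoc]

/-- `(1 ⊗ ξ)(p ⊗ q)` for the word `p` is `p` tensor the value at `q` of `ξ` or of its twist. -/
theorem coef_coderivation_tensor (ξ : Module.End R (T R ι)) (p q v v' : List ι) :
    coefTensor v v' ((TensorProduct.map ξ LinearMap.id + TensorProduct.map (evenPart R deg) ξ
      + TensorProduct.map (oddPart R deg) (twist deg ξ) :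
        T R ι ⊗[R] T R ι →ₗ[R] T R ι ⊗[R] T R ι) (word R p ⊗ₜ word R q)) =
    coef v (ξ (word R p)) * coef v' (word R q) + coef v (word R p) *
      (sign R (wordDeg deg v * (wordDeg deg v' + wordDeg deg q)) * coef v' (ξ (word R q))) := by
  classical
  simp only [LinearMap.add_apply, TensorProduct.map_tmul, map_add, coefTensor_tmul,
    LinearMap.id_apply, evenPart_word, oddPart_word, coef_twist_word]
  rw [add_assoc]
  congr 1
  by_cases hv : p = v
  · subst hv
    rcases Int.even_or_odd (wordDeg deg p) with h | h
    · rw [if_pos h, if_neg (by simpa using h), sign_even (h.mul_right _)]; simp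
    · rw [if_neg (by simpa using h), if_pos h]
      -- For odd |p| the Koszul exponent has the parity of |v'| + |q|, which is the sign contributed
      -- by the twist.
      rw [sign_congr (m := wordDeg deg p * _) (n := wordDeg deg v' + wordDeg deg q), sign_add]
      · simp
      · obtain ⟨c, hc⟩ := h
        rw [hc]
        exact ⟨c * (wordDeg deg v' + wordDeg deg q), by ring⟩
  · rcases Int.even_or_odd (wordDeg deg p) with h | h
    · rw [if_pos h, if_neg (by simpa using h)]; simp [hv]
    · rw [if_neg (by simpa using h), if_pos h]; simp [hv]

/-- This is the coderivation identity paired with v ⊗ v'. As `R` is meant to be even, |v'| + |q| is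
the parity with which ξ acts from q to v', so the Koszul sign makes sense for ξ that are not
homogeneous. -/
theorem mem_coder_iff {ξ : Module.End R (T R ι)} :
    ξ ∈ coder deg ↔ ∀ w v v' : List ι, coef (v ++ v') (ξ (word R w)) =
      rightStrip v' (fun p => coef v (ξ (word R p))) w +
      leftStrip v (fun q => sign R (wordDeg deg v * (wordDeg deg v' + wordDeg deg q)) *
        coef v' (ξ (word R q))) w := by
  classical
  have key : ∀ w v v' : List ι, coefTensor v v' (((TensorProduct.map ξ LinearMap.id +
      TensorProduct.map (evenPart R deg) ξ + TensorProduct.map (oddPart R deg) (twist deg ξ)) ∘ₗ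
        comul R) (word R w)) = rightStrip v' (fun p => coef v (ξ (word R p))) w +
      leftStrip v (fun q => sign R (wordDeg deg v * (wordDeg deg v' + wordDeg deg q)) *
        coef v' (ξ (word R q))) w := by
    intro w v v'
    rw [LinearMap.comp_apply, comul_word, map_sum, map_sum]
    rw [Finset.sum_congr rfl fun i _ => coef_coderivation_tensor ξ _ _ v v',
      Finset.sum_add_distrib]
    simp only [coef_word]
    rw [sum_take_mul v' w (fun p => coef v (ξ (word R p))),
      sum_drop_mul v w (fun q => sign R (wordDeg deg v * (wordDeg deg v' + wordDeg deg q)) *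
        coef v' (ξ (word R q)))]
  constructor
  · intro h w v v'
    rw [← key, ← coefTensor_comul]
    exact congrArg (coefTensor v v') (LinearMap.congr_fun h (word R w))
  · intro h
    refine ext_word fun w => ext_coefTensor fun v v' => ?_
    rw [key, ← h, LinearMap.comp_apply, coefTensor_comul]

theorem component_eq_coef (ξ : Module.End R (T R ι)) (w : List ι) (b : ι) :
    component ξ w b = coef [b] (ξ (word R w)) := rfl

theorem coef_nil_of_mem_coder {ξ : Module.End R (T R ι)} (h : ξ ∈ coder deg) (w : List ι) :
    coef [] (ξ (word R w)) = 0 := by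
  have := mem_coder_iff.1 h w [] []
  simpa using this

theorem coef_cons_of_mem_coder {ξ : Module.End R (T R ι)} (h : ξ ∈ coder deg) (w : List ι)
    (a : ι) (v : List ι) : coef (a :: v) (ξ (word R w)) =
      rightStrip v (fun p => component ξ p a) w +
      leftStrip [a] (fun q => sign R ((deg a + 1) * (wordDeg deg v + wordDeg deg q)) *
        coef v (ξ (word R q))) w := by
  have := mem_coder_iff.1 h w [a] v
  simpa [component_eq_coef] using this

/-- A coderivation is determined by its components. -/
theorem eq_of_component_eq {ξ η : Module.End R (T R ι)} (hξ : ξ ∈ coder deg) (hη : η ∈ coder deg)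
    (h : component ξ = component η) : ξ = η := by
  have key : ∀ v w : List ι, coef v (ξ (word R w)) = coef v (η (word R w)) := by
    intro v
    -- The coefficient of [a|v] is expressed by a component and by coefficients of the shorter word
    -- v.
    induction v with
    | nil => intro w; rw [coef_nil_of_mem_coder hξ, coef_nil_of_mem_coder hη]
    | cons a v ih =>
      intro w
      rw [coef_cons_of_mem_coder hξ, coef_cons_of_mem_coder hη, h]
      simp only [ih]
  exact ext_word fun w => ext_coef fun v => key v w

theorem twist_mem_coder {ξ : Module.End R (T R ι)} (hξ : ξ ∈ coder deg) :
    twist deg ξ ∈ coder deg := by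
  rw [mem_coder_iff]
  intro w v v'
  simp only [coef_twist_word]
  rw [mem_coder_iff.1 hξ w v v', mul_add]
  congr 1
  · by_cases h : ∃ p, w = p ++ v'
    · obtain ⟨p, rfl⟩ := h
      simp only [rightStrip_append, wordDeg_append]
      congr 1
      rw [← sign_add, ← sign_add, sign_congr]
      exact ⟨wordDeg deg v', by ring⟩
    · push Not at h
      rw [rightStrip_of_not _ h, rightStrip_of_not _ h, mul_zero]
  · by_cases h : ∃ p, w = v ++ p
    · obtain ⟨p, rfl⟩ := h
      simp only [leftStrip_append, wordDeg_append]
      rw [mul_left_comm]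
      congr 1
      rw [← sign_add, ← sign_add]
      congr 1
      rw [sign_congr]
      exact ⟨wordDeg deg v, by ring⟩
    · push Not at h
      rw [leftStrip_of_not _ h, leftStrip_of_not _ h, mul_zero]

/-- Homogeneity of a coderivation can be checked on its components. -/
theorem isHomogeneous_of_component {𝒜 : ℤ → AddSubgroup R} {k : ℤ} {ξ : Module.End R (T R ι)}
    (hξ : ξ ∈ coder deg)
    (h : ∀ w b, component ξ w b ∈ 𝒜 (wordDeg deg w + k - (deg b + 1))) :
    IsHomogeneous 𝒜 deg k ξ := by
  intro w v
  rw [repr_eq_coef]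
  induction v generalizing w with
  | nil => rw [coef_nil_of_mem_coder hξ]; exact zero_mem _
  | cons a v ih =>
    rw [coef_cons_of_mem_coder hξ]
    refine add_mem ?_ ?_
    · by_cases h' : ∃ p, w = p ++ v
      · obtain ⟨p, rfl⟩ := h'
        rw [rightStrip_append]
        convert h p a using 2
        simp
        ring
      · push Not at h'
        rw [rightStrip_of_not _ h']
        exact zero_mem _
    · by_cases h' : ∃ p, w = [a] ++ p
      · obtain ⟨p, rfl⟩ := h'
        rw [leftStrip_append]
        refine sign_mul_mem 𝒜 _ ?_
        convert ih p using 2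
        simp
        ring
      · push Not at h'
        rw [leftStrip_of_not _ h']
        exact zero_mem _

theorem IsHomogeneous.component_mem {𝒜 : ℤ → AddSubgroup R} {k : ℤ} {ξ : Module.End R (T R ι)}
    (h : IsHomogeneous 𝒜 deg k ξ) (w : List ι) (b : ι) :
    component ξ w b ∈ 𝒜 (wordDeg deg w + k - (deg b + 1)) := by
  simpa [component_eq_coef, repr_eq_coef] using h w [b]

end Coderivations

end Bar

/-! ### Cofreeness: the coderivation with prescribed components -/

namespace Bar

section Cofree

variable {R : Type*} [CommRing R] {ι : Type*} (deg : ι → ℤ)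

/-- The map `[v] ↦ (-1)^{|a| (|v| + n)} [a|v]`. -/
noncomputable def consSign (a : ι) (n : ℤ) : T R ι →ₗ[R] T R ι :=
  (wordBasis R ι).constr R fun v =>
    sign R ((deg a + 1) * (wordDeg deg v + n)) • word R (a :: v)

theorem consSign_word (a : ι) (n : ℤ) (v : List ι) : consSign deg a n (word R v) =
    sign R ((deg a + 1) * (wordDeg deg v + n)) • word R (a :: v) := by
  conv_lhs => rw [consSign, word, Module.Basis.constr_basis]

theorem coef_nil_consSign (a : ι) (n : ℤ) (x : T R ι) : coef [] (consSign deg a n x) = 0 := by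
  classical
  suffices h : coef [] ∘ₗ consSign (R := R) deg a n = 0 from LinearMap.congr_fun h x
  exact ext_word fun w => by simp [consSign_word]

open Classical in
theorem coef_cons_consSign (a b : ι) (n : ℤ) (v : List ι) (x : T R ι) :
    coef (b :: v) (consSign deg a n x) =
      if a = b then sign R ((deg b + 1) * (wordDeg deg v + n)) * coef v x else 0 := by
  suffices h : coef (b :: v) ∘ₗ consSign (R := R) deg a n =
      if a = b then sign R ((deg b + 1) * (wordDeg deg v + n)) • coef v else 0 by
    have := LinearMap.congr_fun h x
    rw [LinearMap.comp_apply] at this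
    rw [this]
    split_ifs <;> simp
  refine ext_word fun w => ?_
  by_cases hab : a = b
  · subst hab
    simp only [LinearMap.comp_apply, consSign_word, map_smul, coef_word, if_true, List.cons.injEq,
      true_and, LinearMap.smul_apply, smul_eq_mul]
    split_ifs with h
    · rw [h]
    · simp
  · simp [consSign_word, hab]

theorem coef_nil_eq_zero_and_coef_cons [Fintype ι] (φ : List ι → ι → R) (w : List ι) :
    coef [] (∑ i ∈ Finset.range (w.length + 1), ∑ b, φ (w.take i) b • word R (b :: w.drop i)) = 0 ∧
    ∀ b v, coef (b :: v)
      (∑ i ∈ Finset.range (w.length + 1), ∑ b, φ (w.take i) b • word R (b :: w.drop i)) =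
      rightStrip v (fun p => φ p b) w := by
  classical
  constructor
  · simp
  · intro b v
    rw [← sum_take_mul, map_sum]
    refine Finset.sum_congr rfl fun i _ => ?_
    rw [map_sum, Finset.sum_eq_single b]
    · simp
    · intro c _ hc
      simp [hc]
    · simp

/-- The value at a word of the coderivation with components `φ`. -/
noncomputable def cofreeValue [Fintype ι] (φ : List ι → ι → R) : List ι → T R ι
  | [] => ∑ b, φ [] b • word R [b]
  | a :: w => (∑ i ∈ Finset.range ((a :: w).length + 1),
      ∑ b, φ ((a :: w).take i) b • word R (b :: (a :: w).drop i)) +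
        consSign deg a (wordDeg deg w) (cofreeValue φ w)

variable [Fintype ι]

theorem coef_nil_cofreeValue (φ : List ι → ι → R) (w : List ι) :
    coef [] (cofreeValue deg φ w) = 0 := by
  cases w with
  | nil => simp [cofreeValue]
  | cons a w =>
    rw [cofreeValue, map_add, (coef_nil_eq_zero_and_coef_cons φ (a :: w)).1, coef_nil_consSign,
      add_zero]

theorem coef_cons_cofreeValue (φ : List ι → ι → R) (w : List ι) (b : ι) (v : List ι) :
    coef (b :: v) (cofreeValue deg φ w) = rightStrip v (fun p => φ p b) w +
      leftStrip [b] (fun q => sign R ((deg b + 1) * (wordDeg deg v + wordDeg deg q)) *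
        coef v (cofreeValue deg φ q)) w := by
  classical
  cases w with
  | nil =>
    have := (coef_nil_eq_zero_and_coef_cons φ []).2 b v
    rw [leftStrip_singleton_nil, add_zero, ← this]
    simp [cofreeValue]
  | cons a w =>
    rw [cofreeValue, map_add, (coef_nil_eq_zero_and_coef_cons φ (a :: w)).2, coef_cons_consSign,
      leftStrip_singleton_cons]

/-- In a term with output v v', the new letter lies in v or in v'. In the first case v' is an
untouched end of w, in the second v is an untouched beginning. The recursion treats only the first
letter, hence the induction on v. -/
theorem coef_append_cofreeValue (φ : List ι → ι → R) (v v' w : List ι) :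
    coef (v ++ v') (cofreeValue deg φ w) =
      rightStrip v' (fun p => coef v (cofreeValue deg φ p)) w +
      leftStrip v (fun q => sign R (wordDeg deg v * (wordDeg deg v' + wordDeg deg q)) *
        coef v' (cofreeValue deg φ q)) w := by
  classical
  induction v generalizing w with
  | nil =>
    by_cases h : ∃ p, w = p ++ v'
    · obtain ⟨p, rfl⟩ := h
      simp [coef_nil_cofreeValue]
    · push Not at h
      rw [rightStrip_of_not _ h]
      simp
  | cons a v ih =>
    -- Passing first v and then a gives the same sign as passing [a|v] at once: |v| occurs twice in
    -- the exponent and drops out.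
    have hL : leftStrip (a :: v) (fun q => sign R (wordDeg deg (a :: v) *
        (wordDeg deg v' + wordDeg deg q)) * coef v' (cofreeValue deg φ q)) w =
        leftStrip [a] (fun q => sign R ((deg a + 1) * (wordDeg deg (v ++ v') + wordDeg deg q)) *
          leftStrip v (fun q => sign R (wordDeg deg v * (wordDeg deg v' + wordDeg deg q)) *
            coef v' (cofreeValue deg φ q)) q) w := by
      by_cases h : ∃ q, w = a :: v ++ q
      · obtain ⟨q, rfl⟩ := h
        rw [leftStrip_append]
        rw [List.cons_append, leftStrip_singleton_cons, if_pos rfl, leftStrip_append, ← mul_assoc,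
          ← sign_add]
        congr 1
        rw [sign_congr]
        simp only [wordDeg_cons, wordDeg_append]
        exact ⟨-(deg a + 1) * wordDeg deg v, by ring⟩
      · push Not at h
        rw [leftStrip_of_not _ h]
        cases w with
        | nil => simp
        | cons b w =>
          rw [leftStrip_singleton_cons]
          split_ifs with hb
          · subst hb
            rw [leftStrip_of_not, mul_zero]
            intro q hq
            exact h q (by rw [hq]; rfl)
          · rfl
    rw [List.cons_append, coef_cons_cofreeValue, hL]
    simp only [ih, coef_cons_cofreeValue]
    by_cases h : ∃ p, w = p ++ v'
    · obtain ⟨p, rfl⟩ := h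
      rw [rightStrip_append]
      have h1 : rightStrip (v ++ v') (fun p => φ p a) (p ++ v') =
          rightStrip v (fun p => φ p a) p := by
        by_cases h : ∃ r, p = r ++ v
        · obtain ⟨r, rfl⟩ := h
          rw [List.append_assoc, rightStrip_append, rightStrip_append]
        · push Not at h
          rw [rightStrip_of_not _ h, rightStrip_of_not]
          intro r hr
          rw [← List.append_assoc] at hr
          exact h r (List.append_cancel_right hr)
      rw [h1, add_assoc]
      congr 1
      cases p with
      | nil =>
        rw [leftStrip_singleton_nil, zero_add]
        cases v' with
        | nil => simp
        | cons c v' =>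
          rw [List.nil_append, leftStrip_singleton_cons, leftStrip_singleton_cons]
          split_ifs
          · rw [rightStrip_of_not, zero_add]
            intro p hp
            have := congrArg List.length hp
            simp at this
            omega
          · rfl
      | cons c p =>
        rw [List.cons_append, leftStrip_singleton_cons, leftStrip_singleton_cons,
          leftStrip_singleton_cons]
        split_ifs
        · rw [rightStrip_append, mul_add]
          congr 2
          rw [sign_congr]
          simp only [wordDeg_append]
          exact ⟨(deg a + 1) * wordDeg deg v', by ring⟩
        · simp
    · push Not at h
      rw [rightStrip_of_not _ h, rightStrip_of_not, zero_add, zero_add]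
      · cases w with
        | nil => simp
        | cons b w =>
          rw [leftStrip_singleton_cons, leftStrip_singleton_cons]
          split_ifs
          · rw [rightStrip_of_not, zero_add]
            intro p hp
            exact h (b :: p) (by rw [hp]; rfl)
          · rfl
      · intro p hp
        exact h (p ++ v) (by rw [hp, List.append_assoc])

theorem cofreeValue_add (φ ψ : List ι → ι → R) (w : List ι) :
    cofreeValue deg (φ + ψ) w = cofreeValue deg φ w + cofreeValue deg ψ w := by
  induction w with
  | nil => simp [cofreeValue, add_smul, Finset.sum_add_distrib]
  | cons a w ih =>
    simp only [cofreeValue, ih, map_add, Pi.add_apply, add_smul, Finset.sum_add_distrib]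
    abel

theorem cofreeValue_smul (c : R) (φ : List ι → ι → R) (w : List ι) :
    cofreeValue deg (c • φ) w = c • cofreeValue deg φ w := by
  induction w with
  | nil => simp [cofreeValue, mul_smul, Finset.smul_sum]
  | cons a w ih =>
    simp only [cofreeValue, ih, map_smul, Pi.smul_apply, smul_eq_mul, mul_smul, Finset.smul_sum,
      smul_add]

/-- The coderivation with components `φ`. -/
noncomputable def cofree : (List ι → ι → R) →ₗ[R] Module.End R (T R ι) where
  toFun φ := (wordBasis R ι).constr R (cofreeValue deg φ)
  map_add' φ ψ := by
    refine ext_word fun w => ?_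
    simp only [word, LinearMap.add_apply, Module.Basis.constr_basis, cofreeValue_add]
  map_smul' c φ := by
    refine ext_word fun w => ?_
    simp only [word, LinearMap.smul_apply, Module.Basis.constr_basis, cofreeValue_smul,
      RingHom.id_apply]

theorem cofree_word (φ : List ι → ι → R) (w : List ι) :
    cofree deg φ (word R w) = cofreeValue deg φ w :=
  (wordBasis R ι).constr_basis R (cofreeValue deg φ) w

theorem cofree_mem_coder (φ : List ι → ι → R) : cofree deg φ ∈ coder deg := by
  rw [mem_coder_iff]
  intro w v v'
  simp only [cofree_word]
  exact coef_append_cofreeValue deg φ v v' w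

theorem component_cofree (φ : List ι → ι → R) : component (cofree deg φ) = φ := by
  funext w b
  rw [component_eq_coef, cofree_word, coef_cons_cofreeValue, rightStrip_nil]
  simp [coef_nil_cofreeValue, leftStrip]

/-- With `component_cofree`, this identifies coderivations with families of components, so that
cochains can be handled as functions on words. -/
theorem cofree_component {deg : ι → ℤ} {ξ : Module.End R (T R ι)} (h : ξ ∈ coder deg) :
    cofree deg (component ξ) = ξ :=
  eq_of_component_eq (cofree_mem_coder deg _) h (component_cofree deg _)

/-- The value of a coderivation at `[a|w]`. -/
theorem apply_word_cons {deg : ι → ℤ} {ξ : Module.End R (T R ι)} (h : ξ ∈ coder deg) (a : ι)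
    (w : List ι) : ξ (word R (a :: w)) = (∑ i ∈ Finset.range ((a :: w).length + 1),
      ∑ b, component ξ ((a :: w).take i) b • word R (b :: (a :: w).drop i)) +
        consSign deg a (wordDeg deg w) (ξ (word R w)) := by
  conv_lhs => rw [← cofree_component h, cofree_word, cofreeValue]
  rw [← cofree_word, cofree_component h]

theorem apply_word_nil {deg : ι → ℤ} {ξ : Module.End R (T R ι)} (h : ξ ∈ coder deg) :
    ξ (word R []) = ∑ b, component ξ [] b • word R [b] := by
  conv_lhs => rw [← cofree_component h, cofree_word, cofreeValue]

end Cofree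

/-! ### Parity and the graded commutator -/

section Bracket

variable {R : Type*} [CommRing R] {ι : Type*} {deg : ι → ℤ}

/-- The components, as a linear map. -/
noncomputable def components : Module.End R (T R ι) →ₗ[R] List ι → ι → R where
  toFun := component
  map_add' _ _ := by funext w b; simp [component]
  map_smul' _ _ := by funext w b; simp [component]

@[simp] theorem components_apply (ξ : Module.End R (T R ι)) : components ξ = component ξ := rfl

theorem sgn_comp_sgn : sgn R deg ∘ₗ sgn R deg = LinearMap.id := by
  refine ext_word fun w => ?_
  simp [sgn_word, smul_smul]

theorem sgn_sgn (x : T R ι) : sgn R deg (sgn R deg x) = x := by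
  rw [← LinearMap.comp_apply, sgn_comp_sgn, LinearMap.id_apply]

theorem twist_comp (ξ η : Module.End R (T R ι)) :
    twist deg (ξ ∘ₗ η) = twist deg ξ ∘ₗ twist deg η := by
  ext1 x
  simp [twist_apply, sgn_sgn]

theorem twist_twist (ξ : Module.End R (T R ι)) : twist deg (twist deg ξ) = ξ := by
  ext1 x
  simp [twist_apply, sgn_sgn]

/-- The linear map `m` changes the parity of the degree. -/
def IsOdd (deg : ι → ℤ) (m : Module.End R (T R ι)) : Prop :=
  ∀ w v : List ι, Even (wordDeg deg w - wordDeg deg v) → coef v (m (word R w)) = 0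

theorem IsOdd.twist_eq {m : Module.End R (T R ι)} (h : IsOdd deg m) : twist deg m = -m := by
  refine ext_word fun w => ext_coef fun v => ?_
  rw [coef_twist_word, ← sign_add]
  rcases Int.even_or_odd (wordDeg deg w - wordDeg deg v) with h' | h'
  · simp [h w v h']
  · rw [sign_odd]
    · simp
    · rw [add_comm]
      exact (Int.odd_add.2 (by simpa [Int.odd_sub] using h'))

theorem coef_evenPart (v : List ι) (x : T R ι) :
    coef v (evenPart R deg x) = if Even (wordDeg deg v) then coef v x else 0 := by
  classical
  suffices h : coef v ∘ₗ evenPart R deg = if Even (wordDeg deg v) then coef (R := R) v else 0 by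
    have := LinearMap.congr_fun h x
    rw [LinearMap.comp_apply] at this
    rw [this]
    split_ifs <;> rfl
  refine ext_word fun w => ?_
  simp only [LinearMap.comp_apply, evenPart_word]
  by_cases hw : w = v
  · subst hw
    split_ifs <;> simp
  · split_ifs <;> simp [hw]

theorem coef_oddPart (v : List ι) (x : T R ι) :
    coef v (oddPart R deg x) = if Odd (wordDeg deg v) then coef v x else 0 := by
  classical
  suffices h : coef v ∘ₗ oddPart R deg = if Odd (wordDeg deg v) then coef (R := R) v else 0 by
    have := LinearMap.congr_fun h x
    rw [LinearMap.comp_apply] at this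
    rw [this]
    split_ifs <;> rfl
  refine ext_word fun w => ?_
  simp only [LinearMap.comp_apply, oddPart_word]
  by_cases hw : w = v
  · subst hw
    split_ifs <;> simp
  · split_ifs <;> simp [hw]

theorem evenPart_comp_evenPart :
    evenPart R deg ∘ₗ evenPart R deg = evenPart R deg := by
  refine ext_word fun w => ?_
  rw [LinearMap.comp_apply, evenPart_word]
  split_ifs with h <;> simp [evenPart_word, h]

theorem oddPart_comp_oddPart :
    oddPart R deg ∘ₗ oddPart R deg = oddPart R deg := by
  refine ext_word fun w => ?_
  rw [LinearMap.comp_apply, oddPart_word]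
  split_ifs with h
  · rw [oddPart_word, if_pos h]
  · simp

theorem evenPart_comp_oddPart : evenPart R deg ∘ₗ oddPart R deg = 0 := by
  refine ext_word fun w => ?_
  rw [LinearMap.comp_apply, oddPart_word]
  split_ifs with h
  · rw [evenPart_word, if_neg (by simpa using h)]; simp
  · simp

theorem oddPart_comp_evenPart : oddPart R deg ∘ₗ evenPart R deg = 0 := by
  refine ext_word fun w => ?_
  rw [LinearMap.comp_apply, evenPart_word]
  split_ifs with h
  · rw [oddPart_word, if_neg (by simpa using h)]; simp
  · simp

theorem IsOdd.evenPart_comp {m : Module.End R (T R ι)} (h : IsOdd deg m) :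
    evenPart R deg ∘ₗ m = m ∘ₗ oddPart R deg := by
  refine ext_word fun w => ext_coef fun v => ?_
  rw [LinearMap.comp_apply, LinearMap.comp_apply, coef_evenPart, oddPart_word]
  have := h w v
  rw [Int.even_sub] at this
  rcases Int.even_or_odd (wordDeg deg w) with hw | hw <;>
  rcases Int.even_or_odd (wordDeg deg v) with hv | hv
  · rw [if_pos hv, if_neg (Int.not_odd_iff_even.2 hw), this (by simp [hw, hv]), map_zero, map_zero]
  · rw [if_neg (Int.not_even_iff_odd.2 hv), if_neg (Int.not_odd_iff_even.2 hw), map_zero, map_zero]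
  · rw [if_pos hv, if_pos hw]
  · rw [if_neg (Int.not_even_iff_odd.2 hv), if_pos hw,
      this (by simp [Int.not_even_iff_odd.2 hw, Int.not_even_iff_odd.2 hv])]

theorem IsOdd.oddPart_comp {m : Module.End R (T R ι)} (h : IsOdd deg m) :
    oddPart R deg ∘ₗ m = m ∘ₗ evenPart R deg := by
  refine ext_word fun w => ext_coef fun v => ?_
  rw [LinearMap.comp_apply, LinearMap.comp_apply, coef_oddPart, evenPart_word]
  have := h w v
  rw [Int.even_sub] at this
  rcases Int.even_or_odd (wordDeg deg w) with hw | hw <;>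
  rcases Int.even_or_odd (wordDeg deg v) with hv | hv
  · rw [if_neg (Int.not_odd_iff_even.2 hv), if_pos hw, this (by simp [hw, hv])]
  · rw [if_pos hv, if_pos hw]
  · rw [if_neg (Int.not_odd_iff_even.2 hv), if_neg (Int.not_even_iff_odd.2 hw), map_zero, map_zero]
  · rw [if_pos hv, if_neg (Int.not_even_iff_odd.2 hw), map_zero, map_zero,
      this (by simp [Int.not_even_iff_odd.2 hw, Int.not_even_iff_odd.2 hv])]

theorem map_sub_left (f g h : Module.End R (T R ι)) :
    TensorProduct.map (f - g) h = TensorProduct.map f h - TensorProduct.map g h :=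
  LinearMap.congr_fun (map_sub (TensorProduct.mapBilinear (RingHom.id R) _ _ _ _) f g) h

theorem map_sub_right (f g h : Module.End R (T R ι)) :
    TensorProduct.map h (f - g) = TensorProduct.map h f - TensorProduct.map h g :=
  map_sub (TensorProduct.mapBilinear (RingHom.id R) _ _ _ _ h) f g

theorem map_neg_right (f h : Module.End R (T R ι)) :
    TensorProduct.map h (-f) = -TensorProduct.map h f :=
  map_neg (TensorProduct.mapBilinear (RingHom.id R) _ _ _ _ h) f

/-- The graded commutator of a coderivation with an odd coderivation is a coderivation. -/
theorem commutator_mem_coder {m ξ : Module.End R (T R ι)} (hm : m ∈ coder deg)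
    (hodd : IsOdd deg m) (hξ : ξ ∈ coder deg) : ξ ∘ₗ m - m ∘ₗ twist deg ξ ∈ coder deg := by
  have h1 : comul R ∘ₗ m = (TensorProduct.map m LinearMap.id + TensorProduct.map (evenPart R deg) m
      + TensorProduct.map (oddPart R deg) (twist deg m)) ∘ₗ comul R := hm
  have h2 : comul R ∘ₗ ξ = (TensorProduct.map ξ LinearMap.id + TensorProduct.map (evenPart R deg) ξ
      + TensorProduct.map (oddPart R deg) (twist deg ξ)) ∘ₗ comul R := hξ
  have h3 : comul R ∘ₗ twist deg ξ = (TensorProduct.map (twist deg ξ) LinearMap.id +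
      TensorProduct.map (evenPart R deg) (twist deg ξ)
      + TensorProduct.map (oddPart R deg) (twist deg (twist deg ξ))) ∘ₗ comul R :=
    twist_mem_coder hξ
  rw [twist_twist] at h3
  rw [hodd.twist_eq] at h1
  -- The relation `ξ ∘ sgn = sgn ∘ twist ξ`, split into parities. It cancels the cross terms with
  -- `m` in the second tensor factor; those with `m` in the first factor cancel because `m`
  -- exchanges the even and the odd part.
  have hs : ξ ∘ₗ evenPart R deg - ξ ∘ₗ oddPart R deg =
      evenPart R deg ∘ₗ twist deg ξ - oddPart R deg ∘ₗ twist deg ξ := by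
    rw [← LinearMap.comp_sub, ← LinearMap.sub_comp]
    change ξ ∘ₗ sgn R deg = sgn R deg ∘ₗ twist deg ξ
    ext1 x
    simp [twist_apply, sgn_sgn]
  have hs' := congrArg (fun f => TensorProduct.map f m) hs
  simp only [map_sub_left] at hs'
  have ht : twist deg (ξ ∘ₗ m - m ∘ₗ twist deg ξ) = m ∘ₗ ξ - twist deg ξ ∘ₗ m := by
    rw [map_sub, twist_comp, twist_comp, twist_twist, hodd.twist_eq, LinearMap.comp_neg,
      LinearMap.neg_comp]
    abel
  change comul R ∘ₗ (ξ ∘ₗ m - m ∘ₗ twist deg ξ) = _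
  rw [ht, LinearMap.comp_sub, ← LinearMap.comp_assoc, ← LinearMap.comp_assoc, h1, h2,
    LinearMap.comp_assoc, LinearMap.comp_assoc, h1, h3, ← LinearMap.comp_assoc,
    ← LinearMap.comp_assoc, ← LinearMap.sub_comp]
  congr 1
  simp only [LinearMap.add_comp, LinearMap.comp_add, ← TensorProduct.map_comp, LinearMap.id_comp,
    LinearMap.comp_id, evenPart_comp_evenPart, evenPart_comp_oddPart, oddPart_comp_evenPart,
    oddPart_comp_oddPart, TensorProduct.map_zero_left, hodd.evenPart_comp, hodd.oddPart_comp,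
    map_sub_left, map_sub_right, LinearMap.comp_neg,
    LinearMap.neg_comp, map_neg_right]
  rw [← sub_eq_zero] at hs' ⊢
  rw [← hs']
  abel

theorem apply_eq_sum {M : Type*} [AddCommGroup M] [Module R M] (ξ : T R ι →ₗ[R] M) (x : T R ι) :
    ξ x = ((wordBasis R ι).repr x).sum fun u c => c • ξ (word R u) := by
  conv_lhs => rw [← (wordBasis R ι).linearCombination_repr x]
  rw [Finsupp.linearCombination_apply, map_finsuppSum]
  simp only [map_smul]
  rfl

theorem IsHomogeneous.comp {𝒜 : ℤ → AddSubgroup R} [GradedRing 𝒜] {k l : ℤ}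
    {ξ η : Module.End R (T R ι)} (hξ : IsHomogeneous 𝒜 deg k ξ) (hη : IsHomogeneous 𝒜 deg l η) :
    IsHomogeneous 𝒜 deg (k + l) (ξ ∘ₗ η) := by
  intro w v
  rw [repr_eq_coef, LinearMap.comp_apply, apply_eq_sum ξ, Finsupp.sum, map_sum]
  refine sum_mem fun u _ => ?_
  rw [map_smul, smul_eq_mul, repr_eq_coef]
  have := SetLike.mul_mem_graded (hη w u) (hξ u v)
  rw [repr_eq_coef, repr_eq_coef] at this
  convert this using 2
  ring

theorem IsHomogeneous.twist {𝒜 : ℤ → AddSubgroup R} {k : ℤ}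
    {ξ : Module.End R (T R ι)} (hξ : IsHomogeneous 𝒜 deg k ξ) :
    IsHomogeneous 𝒜 deg k (twist deg ξ) := by
  intro w v
  rw [repr_eq_coef, coef_twist_word, ← sign_add]
  exact sign_mul_mem 𝒜 _ (hξ w v)

theorem IsHomogeneous.sub {𝒜 : ℤ → AddSubgroup R} {k : ℤ}
    {ξ η : Module.End R (T R ι)} (hξ : IsHomogeneous 𝒜 deg k ξ) (hη : IsHomogeneous 𝒜 deg k η) :
    IsHomogeneous 𝒜 deg k (ξ - η) := by
  intro w v
  rw [repr_eq_coef, LinearMap.sub_apply, map_sub]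
  exact sub_mem (hξ w v) (hη w v)

end Bracket

end Bar

/-! ### The Hochschild differential of an A∞-algebra -/

namespace AInfinityAlgebra

variable {R : Type*} [CommRing R] {𝒜 : ℤ → AddSubgroup R} {ι : Type*} {deg : ι → ℤ}

/-- As `m` has degree -1, its coefficient between words of equal parity lies in an odd part of `R`,
which is zero. -/
theorem isOdd (h𝒜 : IsEvenlyGraded 𝒜) (A : AInfinityAlgebra 𝒜 deg) : IsOdd deg A.m := by
  intro w v h
  have := A.homogeneous w v
  rw [h𝒜 _ (by
    have : wordDeg deg w + -1 - wordDeg deg v = wordDeg deg w - wordDeg deg v + -1 := by ring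
    rw [this]
    exact h.add_odd (by decide))] at this
  simpa [repr_eq_coef] using this

theorem hochschildD_apply (A : AInfinityAlgebra 𝒜 deg) (ξ : Module.End R (T R ι)) :
    A.hochschildD ξ = ξ ∘ₗ A.m - A.m ∘ₗ twist deg ξ := rfl

theorem hochschildD_mem_coder (h𝒜 : IsEvenlyGraded 𝒜) (A : AInfinityAlgebra 𝒜 deg)
    {ξ : Module.End R (T R ι)} (hξ : ξ ∈ coder deg) : A.hochschildD ξ ∈ coder deg :=
  commutator_mem_coder A.mem_coder (A.isOdd h𝒜) hξ

/-- The twist of `m` is -m, so the mixed terms cancel and only terms with m² remain. -/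
theorem hochschildD_hochschildD (h𝒜 : IsEvenlyGraded 𝒜) (A : AInfinityAlgebra 𝒜 deg)
    (ξ : Module.End R (T R ι)) : A.hochschildD (A.hochschildD ξ) = 0 := by
  simp only [hochschildD_apply, map_sub, twist_comp, twist_twist, (A.isOdd h𝒜).twist_eq]
  ext1 x
  have h : ∀ x, A.m (A.m x) = 0 := LinearMap.congr_fun A.sq_zero
  simp [h]

theorem isHomogeneous_hochschildD [GradedRing 𝒜] (A : AInfinityAlgebra 𝒜 deg) {k : ℤ}
    {ξ : Module.End R (T R ι)} (hξ : IsHomogeneous 𝒜 deg k ξ) :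
    IsHomogeneous 𝒜 deg (k - 1) (A.hochschildD ξ) := by
  rw [hochschildD_apply]
  refine IsHomogeneous.sub ?_ ?_
  · exact hξ.comp A.homogeneous
  · have := A.homogeneous.comp hξ.twist
    rwa [neg_add_eq_sub] at this

end AInfinityAlgebra

/-! ### Words in 1 and y, and the operations on functions of words -/

namespace MooreGen

instance : Fintype MooreGen := ⟨⟨[one, y], by simp⟩, by intro x; cases x <;> simp⟩

theorem sum_eq {M : Type*} [AddCommMonoid M] (f : MooreGen → M) : ∑ b, f b = f one + f y := by
  change (Multiset.map f ↑[one, y]).sum = _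
  simp

variable {R : Type*} [CommRing R]

/-- The sign of a letter of `TΣA`: `[1]` is odd and `[y]` is even. -/
def letterSign (R : Type*) [CommRing R] : MooreGen → R
  | one => -1
  | y => 1

/-- The sign `(-1)^{|w|}` of a word. -/
def wordSign (R : Type*) [CommRing R] (w : List MooreGen) : R := (w.map (letterSign R)).prod

@[simp] theorem wordSign_nil : wordSign R [] = 1 := rfl

@[simp] theorem wordSign_cons (a : MooreGen) (w : List MooreGen) :
    wordSign R (a :: w) = letterSign R a * wordSign R w := by simp [wordSign]

@[simp] theorem wordSign_append (v w : List MooreGen) :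
    wordSign R (v ++ w) = wordSign R v * wordSign R w := by simp [wordSign]

@[simp] theorem letterSign_one : letterSign R one = -1 := rfl

@[simp] theorem letterSign_y : letterSign R y = 1 := rfl

@[simp] theorem wordSign_mul_self (w : List MooreGen) : wordSign R w * wordSign R w = 1 := by
  induction w with
  | nil => simp
  | cons a w ih => cases a <;> simp [ih]

theorem even_deg_y {d : ℤ} (hd : Even d) : Even (MooreGen.deg d y + 1) := by
  rw [MooreGen.deg, add_assoc]
  exact hd.add (by decide)

theorem sign_deg {d : ℤ} (hd : Even d) (a : MooreGen) :
    sign R (MooreGen.deg d a + 1) = letterSign R a := by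
  cases a with
  | one => exact sign_odd (by simp [MooreGen.deg])
  | y => exact sign_even (even_deg_y hd)

theorem sign_wordDeg {d : ℤ} (hd : Even d) (w : List MooreGen) :
    sign R (wordDeg (MooreGen.deg d) w) = wordSign R w := by
  induction w with
  | nil => simp
  | cons a w ih => rw [wordDeg_cons, sign_add, ih, sign_deg hd, wordSign_cons]

open Classical in
/-- The function with value `u (n + k)` at the word `[y|…|y]` of length `n`, and `0` at the words
that contain `[1]`. -/
noncomputable def onPowers (u : ℕ → R) (k : ℕ) (v : List MooreGen) : R :=
  if one ∈ v then 0 else u (v.length + k)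

@[simp] theorem onPowers_cons_one (u : ℕ → R) (k : ℕ) (v : List MooreGen) :
    onPowers u k (one :: v) = 0 := by simp [onPowers]

@[simp] theorem onPowers_cons_y (u : ℕ → R) (k : ℕ) (v : List MooreGen) :
    onPowers u k (y :: v) = onPowers u (k + 1) v := by
  have h : one ∈ y :: v ↔ one ∈ v := by
    rw [List.mem_cons]
    exact or_iff_right (by simp)
  rw [onPowers, onPowers, List.length_cons, add_assoc, add_comm 1 k]
  by_cases hv : one ∈ v
  · rw [if_pos hv, if_pos (h.2 hv)]
  · rw [if_neg hv, if_neg (mt h.1 hv)]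

@[simp] theorem onPowers_nil (u : ℕ → R) (k : ℕ) : onPowers u k [] = u k := by simp [onPowers]

theorem eq_replicate {v : List MooreGen} (h : one ∉ v) : v = List.replicate v.length y := by
  refine List.eq_replicate_iff.2 ⟨rfl, fun b hb => ?_⟩
  cases b with
  | one => exact absurd hb h
  | y => rfl

@[simp] theorem onPowers_replicate (u : ℕ → R) (k n : ℕ) :
    onPowers u k (List.replicate n y) = u (n + k) := by simp [onPowers]

/-- `∑ uᵢ F[1|w']` over the `i` with `w = [y|…|y|w']`, with `i` letters `y`. -/
noncomputable def replacePrefix (u : ℕ → R) (F : List MooreGen → R) (w : List MooreGen) : R :=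
  ∑ i ∈ Finset.range (w.length + 1), onPowers u 0 (w.take i) * F (one :: w.drop i)

/-- The effect on `F` of the coderivation `[y|…|y] ↦ uₙ [1]`. -/
noncomputable def curvature (u : ℕ → R) : (List MooreGen → R) → List MooreGen → R
  | _, [] => 0
  | F, a :: w => replacePrefix u F (a :: w) + letterSign R a * curvature u (fun v => F (a :: v)) w

/-- The effect on `F` of the coderivation `[1|1] ↦ [1]`. -/
noncomputable def contract : (List MooreGen → R) → List MooreGen → R
  | _, [] => 0
  | F, one :: w => leftStrip [one] (fun q => F (one :: q)) w - contract (fun v => F (one :: v)) w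
  | F, y :: w => contract (fun v => F (y :: v)) w

/-- The sum of `u_{i + j + k + 1} g(r)` over the factorizations `w = [y|…|y] r [y|…|y]`, with `i`
letters `y` on the left of `r` and `j` on the right. -/
noncomputable def outerPowers (u : ℕ → R) (g : List MooreGen → R) : ℕ → List MooreGen → R
  | k, [] => u (k + 1) * g []
  | k, one :: w => ∑ i ∈ Finset.range ((one :: w).length + 1),
      g ((one :: w).take i) * onPowers u (k + 1) ((one :: w).drop i)
  | k, y :: w => ∑ i ∈ Finset.range ((y :: w).length + 1),
      g ((y :: w).take i) * onPowers u (k + 1) ((y :: w).drop i) + outerPowers u g (k + 1) w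

/-- The value of a function of a basis element at the part of `m₂` that involves the unit. -/
def unitProduct (G : MooreGen → R) : List MooreGen → R
  | [one, c] => G c
  | [y, one] => -G y
  | _ => 0

theorem unitProduct_of_length_ne (G : MooreGen → R) {w : List MooreGen} (h : w.length ≠ 2) :
    unitProduct G w = 0 := by
  match w with
  | [] => rfl
  | [one] => rfl
  | [y] => rfl
  | [_, _] => simp at h
  | one :: _ :: _ :: _ => rfl
  | y :: one :: _ :: _ => rfl
  | y :: y :: _ :: _ => rfl

theorem sum_unitProduct_singleton (F : List MooreGen → R) (a : MooreGen) :
    ∑ i ∈ Finset.range ([a].length + 1),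
      unitProduct (fun b => F (b :: [a].drop i)) ([a].take i) = 0 := by
  refine Finset.sum_eq_zero fun i hi => unitProduct_of_length_ne _ ?_
  simp
  omega

theorem sum_unitProduct_cons_cons (F : List MooreGen → R) (a b : MooreGen) (w : List MooreGen) :
    ∑ i ∈ Finset.range ((a :: b :: w).length + 1),
      unitProduct (fun c => F (c :: (a :: b :: w).drop i)) ((a :: b :: w).take i) =
      unitProduct (fun c => F (c :: w)) [a, b] := by
  rw [Finset.sum_eq_single 2]
  · rfl
  · intro i hi hne
    refine unitProduct_of_length_ne _ ?_
    simp at hi ⊢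
    omega
  · simp

end MooreGen

/-! ### The structure maps of a Moore algebra and its Hochschild differential in components -/

namespace MooreAlgebra

open MooreGen

variable {R : Type*} [CommRing R] {𝒜 : ℤ → AddSubgroup R} {d : ℤ}

/-- The coefficients of the characteristic series. -/
noncomputable def u (A : MooreAlgebra 𝒜 d) (n : ℕ) : R :=
  component A.m (List.replicate n y) one

theorem u_zero (A : MooreAlgebra 𝒜 d) : A.u 0 = 0 := by
  simp [u, component, A.map_empty]

theorem coeff_charSeries (A : MooreAlgebra 𝒜 d) (n : ℕ) :
    PowerSeries.coeff n A.charSeries = A.u n := by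
  simp [charSeries, u]

theorem wordDeg_replicate (n : ℕ) :
    wordDeg (MooreGen.deg d) (List.replicate n y) = n * (d + 2) := by
  simp [wordDeg, MooreGen.deg]
  left
  ring

theorem component_replicate_y (h𝒜 : IsEvenlyGraded 𝒜) (hd : Even d) (A : MooreAlgebra 𝒜 d)
    (n : ℕ) : component A.m (List.replicate n y) y = 0 := by
  refine A.isOdd h𝒜 _ [y] ?_
  rw [wordDeg_replicate, wordDeg_cons, wordDeg_nil, add_zero]
  refine Even.sub (Even.mul_left ?_ _) (even_deg_y hd)
  exact hd.add (by decide)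

/-- Strict unitality prescribes the components at all words with a letter [1]; the words in y alone
carry the characteristic series. -/
theorem component_m_one (A : MooreAlgebra 𝒜 d) (w : List MooreGen) :
    component A.m w one = onPowers A.u 0 w + unitProduct (fun b => coef [b] (word R [one])) w := by
  classical
  by_cases h : one ∈ w
  · rw [onPowers, if_pos h, zero_add]
    by_cases hl : w.length = 2
    · match w, hl with
      | [one, c], _ =>
        rw [A.unital.left_unit]
        simp [unitProduct]
      | [y, one], _ =>
        rw [A.unital.right_unit]
        simp [unitProduct]
      | [y, y], _ => simp at h
    · rw [A.unital.vanish w hl h, unitProduct_of_length_ne _ hl]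
  · rw [eq_replicate h, onPowers_replicate]
    generalize w.length = n
    have : unitProduct (fun b => coef [b] (word R [one])) (List.replicate n y) = 0 := by
      match n with
      | 0 => rfl
      | 1 => rfl
      | 2 => rfl
      | n + 3 => rfl
    rw [this, add_zero, add_zero, u]

theorem component_m_y (h𝒜 : IsEvenlyGraded 𝒜) (hd : Even d) (A : MooreAlgebra 𝒜 d)
    (w : List MooreGen) :
    component A.m w y = unitProduct (fun b => coef [b] (word R [y])) w := by
  classical
  by_cases h : one ∈ w
  · by_cases hl : w.length = 2
    · match w, hl with
      | [one, c], _ =>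
        rw [A.unital.left_unit]
        simp [unitProduct]
      | [y, one], _ =>
        rw [A.unital.right_unit]
        have : Odd (MooreGen.deg d y) := by
          have := even_deg_y hd
          simpa [Int.even_add_one] using this
        simp [unitProduct, Int.negOnePow_odd _ this]
      | [y, y], _ => simp at h
    · rw [A.unital.vanish w hl h, unitProduct_of_length_ne _ hl]
  · rw [eq_replicate h, component_replicate_y h𝒜 hd]
    generalize w.length = n
    match n with
    | 0 => rfl
    | 1 => rfl
    | 2 => rfl
    | n + 3 => rfl

theorem sum_component_m (h𝒜 : IsEvenlyGraded 𝒜) (hd : Even d) (A : MooreAlgebra 𝒜 d)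
    (w : List MooreGen) (G : MooreGen → R) :
    ∑ b, component A.m w b * G b = onPowers A.u 0 w * G one + unitProduct G w := by
  classical
  rw [sum_eq, component_m_one, component_m_y h𝒜 hd, add_mul, add_assoc]
  congr 1
  by_cases hl : w.length = 2
  · match w, hl with
    | [one, one], _ => simp [unitProduct]
    | [one, y], _ => simp [unitProduct]
    | [y, one], _ => simp [unitProduct]
    | [y, y], _ => simp [unitProduct]
  · simp [unitProduct_of_length_ne _ hl]

/-- Wherever `m` has a nonzero coefficient from w to v, the number |w| - |v| is odd. Passing the
letter a therefore always costs the sign of a. -/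
theorem functional_consSign (h𝒜 : IsEvenlyGraded 𝒜) (hd : Even d) (A : MooreAlgebra 𝒜 d)
    (F : List MooreGen → R) (a : MooreGen) (w : List MooreGen) :
    functional F (consSign (MooreGen.deg d) a (wordDeg (MooreGen.deg d) w) (A.m (word R w))) =
      letterSign R a * functional (fun v => F (a :: v)) (A.m (word R w)) := by
  rw [← LinearMap.comp_apply, apply_eq_sum (functional F ∘ₗ _),
    apply_eq_sum (functional fun v => F (a :: v)), Finsupp.sum, Finsupp.sum, Finset.mul_sum]
  refine Finset.sum_congr rfl fun v _ => ?_
  rw [LinearMap.comp_apply, consSign_word, map_smul, functional_word, functional_word]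
  rcases Int.even_or_odd (wordDeg (MooreGen.deg d) w - wordDeg (MooreGen.deg d) v) with h | h
  · have := A.isOdd h𝒜 w v h
    rw [← repr_eq_coef] at this
    simp [this]
  · rw [← sign_deg hd a, sign_congr (n := MooreGen.deg d a + 1)]
    · simp only [smul_eq_mul]
      ring
    · obtain ⟨c, hc⟩ := h
      refine ⟨(MooreGen.deg d a + 1) * (c + wordDeg (MooreGen.deg d) v), ?_⟩
      rw [eq_add_of_sub_eq hc]
      ring

theorem functional_m_cons (h𝒜 : IsEvenlyGraded 𝒜) (hd : Even d) (A : MooreAlgebra 𝒜 d)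
    (F : List MooreGen → R) (a : MooreGen) (w : List MooreGen) :
    functional F (A.m (word R (a :: w))) = replacePrefix A.u F (a :: w) +
      ∑ i ∈ Finset.range ((a :: w).length + 1),
        unitProduct (fun b => F (b :: (a :: w).drop i)) ((a :: w).take i) +
      letterSign R a * functional (fun v => F (a :: v)) (A.m (word R w)) := by
  rw [apply_word_cons A.mem_coder, map_add, functional_consSign h𝒜 hd, map_sum]
  simp only [map_sum, map_smul, functional_word, smul_eq_mul]
  rw [replacePrefix, ← Finset.sum_add_distrib]
  congr 1
  refine Finset.sum_congr rfl fun i _ => ?_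
  exact sum_component_m h𝒜 hd A _ fun b => F (b :: (a :: w).drop i)

/-- The dual of `m` is the sum of the curvature, of minus the contraction of pairs of units, and of
the commutator with the unit. -/
theorem functional_m (h𝒜 : IsEvenlyGraded 𝒜) (hd : Even d) (A : MooreAlgebra 𝒜 d)
    (F : List MooreGen → R) (w : List MooreGen) :
    functional F (A.m (word R w)) = curvature A.u F w - contract F w + leftStrip [one] F w -
      rightStrip [one] (fun p => wordSign R p * F p) w := by
  -- The unit part of `m` runs over adjacent pairs of letters. An inner [1] can be absorbed by its
  -- left or its right neighbour, with opposite signs, so only the removal of [1] at the two ends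
  -- survives. This count uses the single product of a pair [1|1] twice, which `contract` corrects.
  induction w generalizing F with
  | nil => simp [A.map_empty, curvature, contract]
  | cons a w ih =>
    rw [functional_m_cons h𝒜 hd, ih, curvature, leftStrip_singleton_cons]
    cases w with
    | nil =>
      rw [sum_unitProduct_singleton]
      cases a <;> simp [contract, curvature]
    | cons b w =>
      rw [sum_unitProduct_cons_cons, rightStrip_singleton_cons_cons]
      have h1 : rightStrip [one] (fun p => wordSign R (a :: p) * F (a :: p)) (b :: w) =
          letterSign R a * rightStrip [one] (fun p => wordSign R p * F (a :: p)) (b :: w) := by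
        rw [← rightStrip_mul]
        simp [mul_assoc]
      rw [h1]
      cases a with
      | one =>
        rw [contract, leftStrip_singleton_cons]
        simp only [unitProduct, letterSign_one, if_true]
        ring
      | y =>
        rw [contract.eq_3, leftStrip_singleton_cons]
        cases b <;> simp [unitProduct] <;> ring

theorem functional_onPowers_consSign (hd : Even d) (u : ℕ → R) (k : ℕ) (a : MooreGen) (n : ℤ)
    (x : T R MooreGen) : functional (onPowers u k) (consSign (MooreGen.deg d) a n x) =
      match a with
      | one => 0
      | y => functional (onPowers u (k + 1)) x := by
  cases a with
  | one =>
    suffices h : functional (onPowers u k) ∘ₗ consSign (MooreGen.deg d) one n = 0 from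
      LinearMap.congr_fun h x
    exact ext_word fun w => by simp [consSign_word]
  | y =>
    suffices h : functional (onPowers u k) ∘ₗ consSign (MooreGen.deg d) y n =
      functional (onPowers u (k + 1)) from LinearMap.congr_fun h x
    exact ext_word fun w => by simp [consSign_word, sign_even ((even_deg_y hd).mul_right _)]

/-- Only an output [y] with nothing but letters y around it contributes. Each letter y that is
passed raises the shift k by one, and a letter [1] cannot be passed. -/
theorem functional_onPowers (hd : Even d) (u : ℕ → R) {ξ : Module.End R (T R MooreGen)}
    (hξ : ξ ∈ coder (MooreGen.deg d)) (k : ℕ) (w : List MooreGen) :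
    functional (onPowers u k) (ξ (word R w)) =
      outerPowers u (fun v => component ξ v y) k w := by
  induction w generalizing k with
  | nil =>
    rw [apply_word_nil hξ, map_sum, sum_eq]
    simp [outerPowers, mul_comm]
  | cons a w ih =>
    rw [apply_word_cons hξ, map_add, functional_onPowers_consSign hd, map_sum]
    simp only [sum_eq, map_add, map_smul, functional_word, onPowers_cons_one, onPowers_cons_y,
      mul_zero, zero_add, smul_eq_mul]
    cases a with
    | one => rw [outerPowers, add_zero]
    | y => rw [outerPowers.eq_3, ih]

/-- The words in y alone have even degree, so of the two signs in the twist only that of the input w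
is left. -/
theorem functional_onPowers_twist (hd : Even d) (u : ℕ → R) {ξ : Module.End R (T R MooreGen)}
    (hξ : ξ ∈ coder (MooreGen.deg d)) (w : List MooreGen) :
    functional (onPowers u 0) (twist (MooreGen.deg d) ξ (word R w)) =
      wordSign R w * outerPowers u (fun v => component ξ v y) 0 w := by
  have h : functional (onPowers u 0) ∘ₗ sgn R (MooreGen.deg d) = functional (onPowers u 0) := by
    refine ext_word fun v => ?_
    rw [LinearMap.comp_apply, sgn_word, map_smul, functional_word, smul_eq_mul, sign_wordDeg hd]
    by_cases hv : one ∈ v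
    · simp [onPowers, hv]
    · rw [eq_replicate hv]
      simp [wordSign]
  rw [twist_apply, ← LinearMap.comp_apply (functional _), h, sgn_word, map_smul, map_smul,
    functional_onPowers hd u hξ, sign_wordDeg hd, smul_eq_mul]

theorem coef_one_m (A : MooreAlgebra 𝒜 d) (x : T R MooreGen) :
    coef [one] (A.m x) = functional (onPowers A.u 0) x + coef [one, one] x := by
  suffices h : coef [one] ∘ₗ A.m = functional (onPowers A.u 0) + coef [one, one] from
    LinearMap.congr_fun h x
  refine ext_word fun w => ?_
  rw [LinearMap.comp_apply, ← component_eq_coef, component_m_one, LinearMap.add_apply,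
    functional_word]
  congr 1
  by_cases hl : w.length = 2
  · match w, hl with
    | [one, one], _ => simp [unitProduct]
    | [one, y], _ => simp [unitProduct]
    | [y, one], _ => simp [unitProduct]
    | [y, y], _ => simp [unitProduct]
  · rw [unitProduct_of_length_ne _ hl, coef_word, if_neg]
    rintro rfl
    simp at hl

theorem coef_y_m (h𝒜 : IsEvenlyGraded 𝒜) (hd : Even d) (A : MooreAlgebra 𝒜 d)
    (x : T R MooreGen) : coef [y] (A.m x) = coef [one, y] x - coef [y, one] x := by
  suffices h : coef [y] ∘ₗ A.m = coef [one, y] - coef [y, one] from LinearMap.congr_fun h x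
  refine ext_word fun w => ?_
  rw [LinearMap.comp_apply, ← component_eq_coef, component_m_y h𝒜 hd, LinearMap.sub_apply]
  by_cases hl : w.length = 2
  · match w, hl with
    | [one, one], _ => simp [unitProduct]
    | [one, y], _ => simp [unitProduct]
    | [y, one], _ => simp [unitProduct]
    | [y, y], _ => simp [unitProduct]
  · rw [unitProduct_of_length_ne _ hl, coef_word, coef_word, if_neg, if_neg, sub_zero]
    all_goals
      rintro rfl
      simp at hl

theorem coef_apply_eq_functional (ξ : Module.End R (T R MooreGen)) (b : MooreGen)
    (x : T R MooreGen) : coef [b] (ξ x) = functional (fun v => component ξ v b) x := by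
  suffices h : coef [b] ∘ₗ ξ = functional (fun v => component ξ v b) from LinearMap.congr_fun h x
  exact ext_word fun w => by simp [component_eq_coef]

theorem sign_mul_rightStrip (b : MooreGen) (F : List MooreGen → R) (w : List MooreGen) :
    wordSign R w * rightStrip [b] F w =
      letterSign R b * rightStrip [b] (fun p => wordSign R p * F p) w := by
  by_cases h : ∃ p, w = p ++ [b]
  · obtain ⟨p, rfl⟩ := h
    simp
    ring
  · push Not at h
    simp [rightStrip_of_not _ h]

theorem sign_mul_leftStrip (b : MooreGen) (F : List MooreGen → R) (w : List MooreGen) :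
    wordSign R w * leftStrip [b] (fun q => wordSign R q * F q) w =
      letterSign R b * leftStrip [b] F w := by
  by_cases h : ∃ p, w = [b] ++ p
  · obtain ⟨p, rfl⟩ := h
    rw [leftStrip_append, leftStrip_append]
    simp only [List.cons_append, List.nil_append, wordSign_cons]
    linear_combination letterSign R b * F p * wordSign_mul_self (R := R) p
  · push Not at h
    simp [leftStrip_of_not _ h]

theorem coef_pair_twist (hd : Even d) {ξ : Module.End R (T R MooreGen)}
    (hξ : ξ ∈ coder (MooreGen.deg d)) (a b : MooreGen) (w : List MooreGen) :
    coef [a, b] (twist (MooreGen.deg d) ξ (word R w)) =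
      letterSign R a * letterSign R b * (wordSign R w *
        (rightStrip [b] (fun p => component ξ p a) w +
        leftStrip [a] (fun q => sign R ((MooreGen.deg d a + 1) *
          (MooreGen.deg d b + 1 + wordDeg (MooreGen.deg d) q)) * component ξ q b) w)) := by
  rw [coef_twist_word, sign_wordDeg hd, sign_wordDeg hd, coef_cons_of_mem_coder hξ]
  simp [component_eq_coef]
  ring

/-- The `[1]`-component of the Hochschild differential. -/
theorem component_hochschildD_one (h𝒜 : IsEvenlyGraded 𝒜) (hd : Even d) (A : MooreAlgebra 𝒜 d)
    {ξ : Module.End R (T R MooreGen)} (hξ : ξ ∈ coder (MooreGen.deg d)) (w : List MooreGen) :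
    component (A.hochschildD ξ) w one = curvature A.u (fun v => component ξ v one) w -
      contract (fun v => component ξ v one) w -
      wordSign R w * outerPowers A.u (fun v => component ξ v y) 0 w := by
  rw [AInfinityAlgebra.hochschildD_apply, component_eq_coef, LinearMap.sub_apply, map_sub,
    LinearMap.comp_apply, LinearMap.comp_apply, coef_one_m, functional_onPowers_twist hd A.u hξ,
    coef_pair_twist hd hξ, coef_apply_eq_functional, functional_m h𝒜 hd]
  have h : (fun q => sign R ((MooreGen.deg d one + 1) *
      (MooreGen.deg d one + 1 + wordDeg (MooreGen.deg d) q)) * component ξ q one) =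
      fun q => -1 * (wordSign R q * component ξ q one) := by
    funext q
    have : (MooreGen.deg d one + 1) * (MooreGen.deg d one + 1 + wordDeg (MooreGen.deg d) q) =
      (MooreGen.deg d one + 1) + wordDeg (MooreGen.deg d) q := by simp [MooreGen.deg]
    rw [this, sign_add, sign_deg hd, sign_wordDeg hd, letterSign_one, mul_assoc]
  rw [h, leftStrip_mul]
  -- By these two relations the removal of [1] at the ends, from `functional_m`, cancels against the
  -- coefficient of [1|1] in the twist of ξ.
  have h1 := sign_mul_rightStrip one (fun p => component ξ p one) w
  have h2 := sign_mul_leftStrip one (fun p => component ξ p one) w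
  simp only [letterSign_one] at *
  linear_combination -h1 + h2

/-- The `[y]`-component of the Hochschild differential. -/
theorem component_hochschildD_y (h𝒜 : IsEvenlyGraded 𝒜) (hd : Even d) (A : MooreAlgebra 𝒜 d)
    {ξ : Module.End R (T R MooreGen)} (hξ : ξ ∈ coder (MooreGen.deg d)) (w : List MooreGen) :
    component (A.hochschildD ξ) w y = curvature A.u (fun v => component ξ v y) w -
      contract (fun v => component ξ v y) w +
      wordSign R w * (rightStrip [y] (fun v => component ξ v one) w -
        leftStrip [y] (fun v => component ξ v one) w) := by
  rw [AInfinityAlgebra.hochschildD_apply, component_eq_coef, LinearMap.sub_apply, map_sub,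
    LinearMap.comp_apply, LinearMap.comp_apply, coef_y_m h𝒜 hd,
    coef_pair_twist hd hξ, coef_pair_twist hd hξ, coef_apply_eq_functional, functional_m h𝒜 hd]
  have h : (fun q => sign R ((MooreGen.deg d one + 1) *
      (MooreGen.deg d y + 1 + wordDeg (MooreGen.deg d) q)) * component ξ q y) =
      fun q => wordSign R q * component ξ q y := by
    funext q
    have : (MooreGen.deg d one + 1) * (MooreGen.deg d y + 1 + wordDeg (MooreGen.deg d) q) =
      (MooreGen.deg d y + 1) + wordDeg (MooreGen.deg d) q := by simp [MooreGen.deg]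
    rw [this, sign_add, sign_deg hd, sign_wordDeg hd, letterSign_y, one_mul]
  have h' : (fun q => sign R ((MooreGen.deg d y + 1) *
      (MooreGen.deg d one + 1 + wordDeg (MooreGen.deg d) q)) * component ξ q one) =
      fun q => component ξ q one := by
    funext q
    rw [sign_even ((even_deg_y hd).mul_right _), one_mul]
  rw [h, h']
  -- The strips of [1] cancel as for the other component. The strips of [y] have no counterpart in
  -- `functional_m` and survive as the commutator with y.
  have h1 := sign_mul_rightStrip one (fun p => component ξ p y) w
  have h2 := sign_mul_leftStrip one (fun p => component ξ p y) w
  simp only [letterSign_one, letterSign_y] at *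
  linear_combination -h1 + h2

end MooreAlgebra

/-! ### The filtration by the number of letters y and the contracting homotopy -/

namespace MooreGen

variable {R : Type*} [CommRing R]

/-- The number of letters `y`. -/
def yCount : List MooreGen → ℕ
  | [] => 0
  | one :: w => yCount w
  | y :: w => yCount w + 1

theorem yCount_append (v w : List MooreGen) : yCount (v ++ w) = yCount v + yCount w := by
  induction v with
  | nil => simp [yCount]
  | cons a v ih => cases a <;> simp [yCount, ih]; ring

theorem yCount_take_add_drop (i : ℕ) (w : List MooreGen) :
    yCount (w.take i) + yCount (w.drop i) = yCount w := by
  rw [← yCount_append, List.take_append_drop]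

/-- `F` vanishes at the words that contain `[1]` and have less than `c` letters `y`. -/
def VanishesBelow (c : ℕ) (F : List MooreGen → R) : Prop :=
  ∀ w, one ∈ w → yCount w < c → F w = 0

theorem VanishesBelow.mono {c c' : ℕ} {F : List MooreGen → R} (h : VanishesBelow c F)
    (hc : c' ≤ c) : VanishesBelow c' F := fun w h1 h2 => h w h1 (h2.trans_le hc)

theorem VanishesBelow.add {c : ℕ} {F G : List MooreGen → R} (hF : VanishesBelow c F)
    (hG : VanishesBelow c G) : VanishesBelow c (F + G) := fun w h1 h2 => by
  rw [Pi.add_apply, hF w h1 h2, hG w h1 h2, add_zero]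

theorem VanishesBelow.neg {c : ℕ} {F : List MooreGen → R} (hF : VanishesBelow c F) :
    VanishesBelow c (-F) := fun w h1 h2 => by
  rw [Pi.neg_apply, hF w h1 h2, neg_zero]

theorem VanishesBelow.sub {c : ℕ} {F G : List MooreGen → R} (hF : VanishesBelow c F)
    (hG : VanishesBelow c G) : VanishesBelow c (F - G) := sub_eq_add_neg F G ▸ hF.add hG.neg

theorem VanishesBelow.mul {c : ℕ} {F : List MooreGen → R} (hF : VanishesBelow c F)
    (G : List MooreGen → R) : VanishesBelow c (G * F) := fun w h1 h2 => by
  rw [Pi.mul_apply, hF w h1 h2, mul_zero]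

theorem VanishesBelow.cons_one {c : ℕ} {F : List MooreGen → R} (h : VanishesBelow c F) :
    VanishesBelow c fun v => F (one :: v) :=
  fun w _ h2 => h (one :: w) List.mem_cons_self h2

theorem VanishesBelow.cons_y {c : ℕ} {F : List MooreGen → R} (h : VanishesBelow (c + 1) F) :
    VanishesBelow c fun v => F (y :: v) :=
  fun w h1 h2 => h (y :: w) (List.mem_cons_of_mem _ h1) (by rw [yCount]; omega)

/-- As u₀ = 0, at least one letter y is replaced by [1]. The argument of `F` thus contains [1] and
has fewer letters y than w, even if w itself contains no [1]. -/
theorem replacePrefix_eq_zero {u : ℕ → R} (hu : u 0 = 0) {c : ℕ} {F : List MooreGen → R}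
    (h : VanishesBelow c F) {w : List MooreGen} (hw : yCount w < c + 1) :
    replacePrefix u F w = 0 := by
  refine Finset.sum_eq_zero fun i _ => ?_
  have hc := yCount_take_add_drop i w
  generalize hp : w.take i = p at *
  match p with
  | [] => simp [hu]
  | one :: p => simp
  | y :: p =>
    rw [yCount] at hc
    rw [h (one :: w.drop i) List.mem_cons_self (by rw [yCount]; omega), mul_zero]

theorem curvature_eq_zero {u : ℕ → R} (hu : u 0 = 0) {c : ℕ} {F : List MooreGen → R}
    (h : VanishesBelow c F) {w : List MooreGen} (hw : yCount w < c + 1) : curvature u F w = 0 := by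
  induction w generalizing F c with
  | nil => rfl
  | cons a w ih =>
    rw [curvature, replacePrefix_eq_zero hu h hw, zero_add]
    cases a with
    | one => rw [ih h.cons_one hw, mul_zero]
    | y =>
      cases c with
      | zero => simp [yCount] at hw
      | succ c => rw [ih h.cons_y (by rw [yCount] at hw; omega), mul_zero]

theorem contract_eq_zero {c : ℕ} {F : List MooreGen → R}
    (h : VanishesBelow c F) {w : List MooreGen} (hw : yCount w < c) : contract F w = 0 := by
  induction w generalizing F c with
  | nil => rfl
  | cons a w ih =>
    cases a with
    | one =>
      rw [contract, ih h.cons_one hw, sub_zero]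
      match w with
      | [] => simp
      | y :: w => simp
      | one :: w =>
        rw [leftStrip_singleton_cons, if_pos rfl]
        exact h _ List.mem_cons_self hw
    | y =>
      cases c with
      | zero => simp at hw
      | succ c => rw [contract, ih h.cons_y (by rw [yCount] at hw; omega)]

/-- The letters removed around the factor r are all y, so r still contains [1] and has at most as
many letters y as w. -/
theorem VanishesBelow.outerPowers (u : ℕ → R) {c : ℕ} {F : List MooreGen → R}
    (h : VanishesBelow c F) (k : ℕ) : VanishesBelow c (outerPowers u F k) := by
  have key : ∀ w, one ∈ w → yCount w < c → ∀ k, ∑ i ∈ Finset.range (w.length + 1),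
      F (w.take i) * onPowers u (k + 1) (w.drop i) = 0 := by
    intro w h1 hw k
    refine Finset.sum_eq_zero fun i _ => ?_
    by_cases hd : one ∈ w.drop i
    · rw [onPowers, if_pos hd, mul_zero]
    · rw [← List.take_append_drop i w, List.mem_append] at h1
      have := yCount_take_add_drop i w
      rw [h _ (h1.resolve_right hd) (by omega), zero_mul]
  intro w
  induction w generalizing k with
  | nil => intro h; simp at h
  | cons a w ih =>
    intro h1 hw
    cases a with
    | one => rw [MooreGen.outerPowers, key _ h1 hw]
    | y =>
      rw [MooreGen.outerPowers, key _ h1 hw, zero_add]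
      refine ih _ ?_ ?_
      · rcases List.mem_cons.1 h1 with h | h
        · cases h
        · exact h
      · rw [yCount] at hw; omega

theorem VanishesBelow.rightStrip {c : ℕ} {F : List MooreGen → R} (h : VanishesBelow c F) :
    VanishesBelow (c + 1) (rightStrip [y] F) := by
  intro w h1 hw
  by_cases hp : ∃ p, w = p ++ [y]
  · obtain ⟨p, rfl⟩ := hp
    rw [rightStrip_append]
    rw [yCount_append] at hw
    refine h p ?_ ?_
    · rcases List.mem_append.1 h1 with h | h
      · exact h
      · rw [List.mem_singleton] at h
        cases h
    · simp [yCount] at hw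
      omega
  · push Not at hp
    exact rightStrip_of_not _ hp

theorem VanishesBelow.leftStrip {c : ℕ} {F : List MooreGen → R} (h : VanishesBelow c F) :
    VanishesBelow (c + 1) (leftStrip [y] F) := by
  intro w h1 hw
  match w with
  | [] => simp
  | one :: w => simp
  | y :: w =>
    rw [leftStrip_singleton_cons, if_pos rfl]
    refine h w ?_ ?_
    · rcases List.mem_cons.1 h1 with h | h
      · cases h
      · exact h
    · rw [yCount] at hw; omega

theorem contract_neg (F : List MooreGen → R) (w : List MooreGen) :
    contract (fun v => -F v) w = -contract F w := by
  induction w generalizing F with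
  | nil => simp [contract]
  | cons a w ih =>
    cases a with
    | one =>
      rw [contract, contract, ih fun v => F (one :: v)]
      have := leftStrip_mul [one] (-1) (fun q => F (one :: q)) w
      simp only [neg_mul, one_mul] at this
      rw [this]
      ring
    | y => rw [contract, contract, ih fun v => F (y :: v)]

/-- Doubles the first letter `1` of the argument, with a sign; `0` at words without this letter. -/
def doubleUnitFun : (List MooreGen → R) → List MooreGen → R
  | _, [] => 0
  | F, one :: w => -F (one :: one :: w)
  | F, y :: w => doubleUnitFun (fun v => F (y :: v)) w

/-- `doubleUnitFun` as a linear map. It is a contracting homotopy for `contract` at the words that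
contain `[1]`. -/
def doubleUnit : (List MooreGen → R) →ₗ[R] List MooreGen → R where
  toFun := doubleUnitFun
  map_add' F G := by
    funext w
    induction w generalizing F G with
    | nil => simp [doubleUnitFun]
    | cons a w ih =>
      cases a with
      | one => simp [doubleUnitFun, add_comm]
      | y => exact ih (fun v => F (y :: v)) (fun v => G (y :: v))
  map_smul' c F := by
    funext w
    induction w generalizing F with
    | nil => simp [doubleUnitFun]
    | cons a w ih =>
      cases a with
      | one => simp [doubleUnitFun]
      | y => exact ih (fun v => F (y :: v))

@[simp] theorem doubleUnit_one (F : List MooreGen → R) (w : List MooreGen) :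
    doubleUnit F (one :: w) = -F (one :: one :: w) := rfl

@[simp] theorem doubleUnit_y (F : List MooreGen → R) (w : List MooreGen) :
    doubleUnit F (y :: w) = doubleUnit (fun v => F (y :: v)) w := rfl

theorem doubleUnit_eq_zero {c : ℕ} {F : List MooreGen → R} (h : VanishesBelow c F)
    {w : List MooreGen} (hw : yCount w < c) : doubleUnit F w = 0 := by
  induction w generalizing F c with
  | nil => rfl
  | cons a w ih =>
    cases a with
    | one => rw [doubleUnit_one, h (one :: one :: w) List.mem_cons_self hw, neg_zero]
    | y =>
      cases c with
      | zero => simp at hw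
      | succ c => rw [doubleUnit_y, ih h.cons_y (by rw [yCount] at hw; omega)]

theorem VanishesBelow.doubleUnit {c : ℕ} {F : List MooreGen → R} (h : VanishesBelow c F) :
    VanishesBelow c (doubleUnit F) := fun _ _ hw => doubleUnit_eq_zero h hw

theorem VanishesBelow.curvature {u : ℕ → R} (hu : u 0 = 0) {c : ℕ} {F : List MooreGen → R}
    (h : VanishesBelow c F) : VanishesBelow (c + 1) (curvature u F) :=
  fun _ _ hw => curvature_eq_zero hu h hw

theorem VanishesBelow.contract {c : ℕ} {F : List MooreGen → R} (h : VanishesBelow c F) :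
    VanishesBelow c (contract F) := fun _ _ hw => contract_eq_zero h hw

/-- This is the extra degeneracy of the bar complex of the unit: the pair created by doubling
contracts back to the word, up to the sign chosen in `doubleUnit`, and every other contraction
occurs twice with opposite signs. Letters y in front of the first [1] are passed without sign. -/
theorem contract_doubleUnit (F : List MooreGen → R) {w : List MooreGen} (hw : one ∈ w) :
    contract (doubleUnit F) w + doubleUnit (contract F) w = -F w := by
  induction w generalizing F with
  | nil => simp at hw
  | cons a w ih =>
    cases a with
    | one =>
      rw [contract, doubleUnit_one, contract, contract, leftStrip_singleton_cons, if_pos rfl]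
      simp only [doubleUnit_one]
      rw [contract_neg fun v => F (one :: one :: v)]
      have := leftStrip_mul [one] (-1) (fun q => F (one :: one :: q)) w
      simp only [neg_mul, one_mul] at this
      rw [this]
      ring
    | y =>
      rw [contract, doubleUnit_y]
      refine ih (fun v => F (y :: v)) ?_
      rcases List.mem_cons.1 hw with h | h
      · cases h
      · exact h

theorem doubleUnit_mem {𝒜 : ℤ → AddSubgroup R} {deg : MooreGen → ℤ} (hdeg : deg one = 0) {e : ℤ}
    {F : List MooreGen → R} (h : ∀ w, F w ∈ 𝒜 (wordDeg deg w + e)) (w : List MooreGen) :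
    doubleUnit F w ∈ 𝒜 (wordDeg deg w + 1 + e) := by
  induction w generalizing F e with
  | nil => exact zero_mem _
  | cons a w ih =>
    cases a with
    | one =>
      rw [doubleUnit_one]
      refine neg_mem ?_
      convert h (one :: one :: w) using 2
      simp [hdeg]
      ring
    | y =>
      rw [doubleUnit_y]
      convert ih (e := deg y + 1 + e) (F := fun v => F (y :: v)) ?_ using 2
      · rw [wordDeg_cons]; ring
      · intro v
        convert h (y :: v) using 2
        rw [wordDeg_cons]; ring

end MooreGen

/-! ### Normalization of cochains -/

namespace MooreAlgebra

open MooreGen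

variable {R : Type*} [CommRing R] {𝒜 : ℤ → AddSubgroup R} {d : ℤ}

/-- The Hochschild differential on the components. -/
noncomputable def differential (A : MooreAlgebra 𝒜 d) :
    (List MooreGen → MooreGen → R) →ₗ[R] List MooreGen → MooreGen → R :=
  components ∘ₗ A.hochschildD ∘ₗ cofree (MooreGen.deg d)

theorem differential_apply (A : MooreAlgebra 𝒜 d) (φ : List MooreGen → MooreGen → R) :
    A.differential φ = component (A.hochschildD (cofree (MooreGen.deg d) φ)) := by
  rw [differential, LinearMap.comp_apply, LinearMap.comp_apply, components_apply]

theorem cofree_differential (h𝒜 : IsEvenlyGraded 𝒜) (A : MooreAlgebra 𝒜 d)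
    (φ : List MooreGen → MooreGen → R) : cofree (MooreGen.deg d) (A.differential φ) =
      A.hochschildD (cofree (MooreGen.deg d) φ) := by
  rw [differential_apply, cofree_component (A.hochschildD_mem_coder h𝒜 (cofree_mem_coder _ _))]

theorem differential_component (A : MooreAlgebra 𝒜 d) {ξ : Module.End R (T R MooreGen)}
    (hξ : ξ ∈ coder (MooreGen.deg d)) :
    A.differential (component ξ) = component (A.hochschildD ξ) := by
  rw [differential_apply, cofree_component hξ]

theorem differential_differential (h𝒜 : IsEvenlyGraded 𝒜) (A : MooreAlgebra 𝒜 d)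
    (φ : List MooreGen → MooreGen → R) : A.differential (A.differential φ) = 0 := by
  rw [differential_apply, cofree_differential h𝒜, A.hochschildD_hochschildD h𝒜,
    ← components_apply, map_zero]

theorem differential_one (h𝒜 : IsEvenlyGraded 𝒜) (hd : Even d) (A : MooreAlgebra 𝒜 d)
    (φ : List MooreGen → MooreGen → R) :
    (fun w => A.differential φ w one) = curvature A.u (fun v => φ v one) -
      contract (fun v => φ v one) - wordSign R * outerPowers A.u (fun v => φ v y) 0 := by
  funext w
  have := component_hochschildD_one h𝒜 hd A (cofree_mem_coder (MooreGen.deg d) φ) w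
  rwa [component_cofree] at this

theorem differential_y (h𝒜 : IsEvenlyGraded 𝒜) (hd : Even d) (A : MooreAlgebra 𝒜 d)
    (φ : List MooreGen → MooreGen → R) :
    (fun w => A.differential φ w y) = curvature A.u (fun v => φ v y) -
      contract (fun v => φ v y) + wordSign R *
        (rightStrip [y] (fun v => φ v one) - leftStrip [y] (fun v => φ v one)) := by
  funext w
  have := component_hochschildD_y h𝒜 hd A (cofree_mem_coder (MooreGen.deg d) φ) w
  rwa [component_cofree] at this

/-- The cochain `φ` vanishes as soon as one of its arguments is the unit. -/
def IsNormalized (φ : List MooreGen → MooreGen → R) : Prop :=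
  ∀ w b, one ∈ w → φ w b = 0

theorem isNormalized_iff {φ : List MooreGen → MooreGen → R} :
    IsNormalized φ ↔ ∀ c b, VanishesBelow c fun w => φ w b :=
  ⟨fun h _ b w hw _ => h w b hw, fun h w b hw => h (yCount w + 1) b w hw (Nat.lt_succ_self _)⟩

/-- The homotopy `doubleUnit` on cochains. -/
def homotopy : (List MooreGen → MooreGen → R) →ₗ[R] List MooreGen → MooreGen → R where
  toFun φ w b := doubleUnit (fun v => φ v b) w
  map_add' φ ψ := by
    funext w b
    exact congrFun (map_add doubleUnit (fun v => φ v b) fun v => ψ v b) w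
  map_smul' c φ := by
    funext w b
    exact congrFun (map_smul doubleUnit c fun v => φ v b) w

theorem homotopy_apply (φ : List MooreGen → MooreGen → R) (b : MooreGen) :
    (fun w => homotopy φ w b) = doubleUnit fun v => φ v b := rfl

theorem doubleUnit_eq_zero_of_forall {F : List MooreGen → R} (h : ∀ c, VanishesBelow c F) :
    doubleUnit F = 0 := by
  funext w
  exact doubleUnit_eq_zero (h (yCount w + 1)) (Nat.lt_succ_self _)

/-- Continuity of the differential for the filtration, which is needed for infinite sums of
homotopies. With all c at once it shows that normalized cochains form a subcomplex. -/
theorem vanishesBelow_differential (h𝒜 : IsEvenlyGraded 𝒜) (hd : Even d) (A : MooreAlgebra 𝒜 d)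
    {c : ℕ} {φ : List MooreGen → MooreGen → R} (h : ∀ b, VanishesBelow c fun w => φ w b)
    (b : MooreGen) : VanishesBelow c fun w => A.differential φ w b := by
  cases b with
  | one =>
    rw [differential_one h𝒜 hd]
    exact (((h one).curvature A.u_zero).mono (Nat.le_succ c)).sub (h one).contract
      |>.sub (((h y).outerPowers A.u 0).mul _)
  | y =>
    rw [differential_y h𝒜 hd]
    exact (((h y).curvature A.u_zero).mono (Nat.le_succ c)).sub (h y).contract
      |>.add ((((h one).rightStrip.sub (h one).leftStrip).mono (Nat.le_succ c)).mul _)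

/-- The filtration of the cochains by the number of letters `y`, where an output `[y]` counts as
half a letter less than an output `[1]`. -/
def Filtered (n : ℕ) (φ : List MooreGen → MooreGen → R) : Prop :=
  VanishesBelow (n / 2) (fun w => φ w one) ∧ VanishesBelow ((n + 1) / 2) (fun w => φ w y)

/-- At the words that contain [1], the `contract` parts of D h + h D give the identity, and h D φ =
0 because D φ is normalized. So φ - D h φ consists of the other parts of D. Curvature gains a letter
y. `outerPowers` leads from output [y] to output [1] without gain, and stripping y leads from [1] to
[y] with the gain of a letter; since [y] counts half a letter less, either gains half a letter. -/
theorem filtered_step (h𝒜 : IsEvenlyGraded 𝒜) (hd : Even d) (A : MooreAlgebra 𝒜 d) {n : ℕ}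
    {φ : List MooreGen → MooreGen → R} (h : Filtered n φ)
    (hφ : IsNormalized (A.differential φ)) :
    Filtered (n + 1) (φ - A.differential (homotopy φ)) := by
  rw [isNormalized_iff] at hφ
  obtain ⟨h1, hy⟩ := h
  constructor
  · have e : (n + 1) / 2 ≤ n / 2 + 1 := by omega
    have h0 := doubleUnit_eq_zero_of_forall fun c => hφ c one
    rw [differential_one h𝒜 hd, map_sub, map_sub, sub_sub, sub_eq_zero] at h0
    have key : ∀ w, one ∈ w → (φ - A.differential (homotopy φ)) w one =
        (-curvature A.u (doubleUnit fun v => φ v one) -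
          doubleUnit (curvature A.u fun v => φ v one) +
          doubleUnit (wordSign R * outerPowers A.u (fun v => φ v y) 0) +
          wordSign R * outerPowers A.u (doubleUnit fun v => φ v y) 0) w := by
      intro w hw
      have h2 := congrFun (differential_one h𝒜 hd A (homotopy φ)) w
      have h3 := contract_doubleUnit (fun v => φ v one) hw
      have h4 := congrFun h0 w
      simp only [homotopy_apply, Pi.sub_apply, Pi.mul_apply, Pi.add_apply, Pi.neg_apply] at h2 h4 ⊢
      linear_combination -h2 + h3 + h4
    intro w hw hc
    dsimp only
    rw [key w hw]
    exact (((h1.doubleUnit.curvature A.u_zero).mono e).neg.sub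
      ((h1.curvature A.u_zero).doubleUnit.mono e)
      |>.add ((hy.outerPowers A.u 0).mul _).doubleUnit
      |>.add ((hy.doubleUnit.outerPowers A.u 0).mul _)) w hw hc
  · have e : (n + 1 + 1) / 2 ≤ n / 2 + 1 := by omega
    have e' : (n + 1 + 1) / 2 ≤ (n + 1) / 2 + 1 := by omega
    have h0 := doubleUnit_eq_zero_of_forall fun c => hφ c y
    rw [differential_y h𝒜 hd, map_add, map_sub] at h0
    have key : ∀ w, one ∈ w → (φ - A.differential (homotopy φ)) w y =
        (-curvature A.u (doubleUnit fun v => φ v y) -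
          doubleUnit (curvature A.u fun v => φ v y) -
          doubleUnit (wordSign R *
            (rightStrip [y] (fun v => φ v one) - leftStrip [y] (fun v => φ v one))) -
          wordSign R * (rightStrip [y] (doubleUnit fun v => φ v one) -
            leftStrip [y] (doubleUnit fun v => φ v one))) w := by
      intro w hw
      have h2 := congrFun (differential_y h𝒜 hd A (homotopy φ)) w
      have h3 := contract_doubleUnit (fun v => φ v y) hw
      have h4 := congrFun h0 w
      simp only [homotopy_apply, Pi.sub_apply, Pi.mul_apply, Pi.add_apply, Pi.neg_apply,
        Pi.zero_apply] at h2 h4 ⊢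
      linear_combination -h2 + h3 + h4
    intro w hw hc
    dsimp only
    rw [key w hw]
    exact (((hy.doubleUnit.curvature A.u_zero).mono e').neg.sub
      ((hy.curvature A.u_zero).doubleUnit.mono e')
      |>.sub ((((h1.rightStrip.sub h1.leftStrip).mul _).doubleUnit).mono e)
      |>.sub (((h1.doubleUnit.rightStrip.sub h1.doubleUnit.leftStrip).mul _).mono e)) w hw hc

/-- One step of the normalization. -/
noncomputable def step (A : MooreAlgebra 𝒜 d) : Module.End R (List MooreGen → MooreGen → R) :=
  LinearMap.id - A.differential ∘ₗ homotopy

theorem step_apply (A : MooreAlgebra 𝒜 d) (φ : List MooreGen → MooreGen → R) :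
    A.step φ = φ - A.differential (homotopy φ) := rfl

theorem differential_step_pow (h𝒜 : IsEvenlyGraded 𝒜) (A : MooreAlgebra 𝒜 d)
    (φ : List MooreGen → MooreGen → R) (n : ℕ) :
    A.differential ((A.step ^ n) φ) = A.differential φ := by
  induction n with
  | zero => simp
  | succ n ih =>
    rw [pow_succ', Module.End.mul_apply, step_apply, map_sub, differential_differential h𝒜,
      sub_zero, ih]

theorem filtered_step_pow (h𝒜 : IsEvenlyGraded 𝒜) (hd : Even d) (A : MooreAlgebra 𝒜 d)
    {φ : List MooreGen → MooreGen → R} (hφ : IsNormalized (A.differential φ)) (n : ℕ) :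
    Filtered n ((A.step ^ n) φ) := by
  induction n with
  | zero => exact ⟨fun w _ h => by simp at h, fun w _ h => by simp at h⟩
  | succ n ih =>
    rw [pow_succ', Module.End.mul_apply, step_apply]
    exact filtered_step h𝒜 hd A ih (by rwa [differential_step_pow h𝒜])

/-- The sum of the homotopies of all steps; at each word it is finite. -/
noncomputable def normalizer (A : MooreAlgebra 𝒜 d) :
    (List MooreGen → MooreGen → R) →ₗ[R] List MooreGen → MooreGen → R where
  toFun φ w b := ∑ n ∈ Finset.range (2 * yCount w + 2), homotopy ((A.step ^ n) φ) w b
  map_add' φ ψ := by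
    funext w b
    simp [Finset.sum_add_distrib]
  map_smul' c φ := by
    funext w b
    simp [Finset.mul_sum]

theorem normalizer_apply (A : MooreAlgebra 𝒜 d) (φ : List MooreGen → MooreGen → R)
    (w : List MooreGen) (b : MooreGen) : A.normalizer φ w b =
      ∑ n ∈ Finset.range (2 * yCount w + 2), MooreAlgebra.homotopy ((A.step ^ n) φ) w b := rfl

theorem sub_differential_sum (A : MooreAlgebra 𝒜 d) (φ : List MooreGen → MooreGen → R) (N : ℕ) :
    φ - A.differential (∑ n ∈ Finset.range N, homotopy ((A.step ^ n) φ)) = (A.step ^ N) φ := by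
  induction N with
  | zero => simp
  | succ N ih =>
    rw [Finset.sum_range_succ, map_add, ← sub_sub, ih, pow_succ', Module.End.mul_apply, step_apply]

/-- Below c the infinite sum agrees with the sum `S` of its first 2c terms, and D preserves this
agreement. For `S` the difference telescopes to the 2c-th iterate of `step`, which vanishes below c
by `filtered_step_pow`. -/
theorem isNormalized_sub_normalizer (h𝒜 : IsEvenlyGraded 𝒜) (hd : Even d) (A : MooreAlgebra 𝒜 d)
    {φ : List MooreGen → MooreGen → R} (hφ : IsNormalized (A.differential φ)) :
    IsNormalized (φ - A.differential (A.normalizer φ)) := by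
  rw [isNormalized_iff]
  intro c
  set S := ∑ n ∈ Finset.range (2 * c), homotopy ((A.step ^ n) φ) with hS
  have h1 : φ - A.differential (A.normalizer φ) =
      (A.step ^ (2 * c)) φ - A.differential (A.normalizer φ - S) := by
    rw [← sub_differential_sum, map_sub]
    abel
  have h2 : ∀ b, VanishesBelow c fun w => (A.normalizer φ - S) w b := by
    intro b w _ hw
    have : A.normalizer φ w b = S w b := by
      rw [hS, Finset.sum_apply, Finset.sum_apply]
      -- For n ≥ 2 yCount w + 2 the iterate has filtration beyond yCount w for both outputs, so its
      -- homotopy is zero at w.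
      refine Finset.sum_subset (Finset.range_mono (by omega)) fun n _ hn => ?_
      rw [Finset.mem_range, not_lt] at hn
      obtain ⟨f1, fy⟩ := filtered_step_pow h𝒜 hd A hφ n
      cases b with
      | one => exact doubleUnit_eq_zero f1 (by omega)
      | y => exact doubleUnit_eq_zero fy (by omega)
    exact sub_eq_zero.2 this
  have h3 : ∀ b, VanishesBelow c fun w => (A.step ^ (2 * c)) φ w b := by
    obtain ⟨f1, fy⟩ := filtered_step_pow h𝒜 hd A hφ (2 * c)
    intro b
    cases b with
    | one => exact f1.mono (by omega)
    | y => exact fy.mono (by omega)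
  intro b
  rw [h1]
  exact (h3 b).sub (vanishesBelow_differential h𝒜 hd A h2 b)

/-- The cochain `φ` is homogeneous of degree `k`. -/
def IsHomogeneousCochain (𝒜 : ℤ → AddSubgroup R) (d k : ℤ)
    (φ : List MooreGen → MooreGen → R) : Prop :=
  ∀ w b, φ w b ∈ 𝒜 (wordDeg (MooreGen.deg d) w + k - (MooreGen.deg d b + 1))

theorem isHomogeneous_cofree {k : ℤ} {φ : List MooreGen → MooreGen → R}
    (h : IsHomogeneousCochain 𝒜 d k φ) :
    IsHomogeneous 𝒜 (MooreGen.deg d) k (cofree (MooreGen.deg d) φ) := by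
  refine isHomogeneous_of_component (cofree_mem_coder _ _) ?_
  rwa [component_cofree]

theorem IsHomogeneousCochain.sub {k : ℤ} {φ ψ : List MooreGen → MooreGen → R}
    (hφ : IsHomogeneousCochain 𝒜 d k φ) (hψ : IsHomogeneousCochain 𝒜 d k ψ) :
    IsHomogeneousCochain 𝒜 d k (φ - ψ) := fun w b => sub_mem (hφ w b) (hψ w b)

theorem IsHomogeneousCochain.differential [GradedRing 𝒜] (A : MooreAlgebra 𝒜 d) {k : ℤ}
    {φ : List MooreGen → MooreGen → R} (h : IsHomogeneousCochain 𝒜 d k φ) :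
    IsHomogeneousCochain 𝒜 d (k - 1) (A.differential φ) :=
  fun w b => (A.isHomogeneous_hochschildD (isHomogeneous_cofree h)).component_mem w b

theorem IsHomogeneousCochain.homotopy {k : ℤ} {φ : List MooreGen → MooreGen → R}
    (h : IsHomogeneousCochain 𝒜 d k φ) : IsHomogeneousCochain 𝒜 d (k + 1) (homotopy φ) := by
  intro w b
  have := doubleUnit_mem (𝒜 := 𝒜) (deg := MooreGen.deg d) rfl (e := k - (MooreGen.deg d b + 1))
    (F := fun v => φ v b) (fun v => by rw [← add_sub_assoc]; exact h v b) w
  rw [add_assoc, ← add_sub_assoc, add_comm 1, ← add_sub_assoc] at this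
  exact this

theorem IsHomogeneousCochain.step_pow [GradedRing 𝒜] (A : MooreAlgebra 𝒜 d) {k : ℤ}
    {φ : List MooreGen → MooreGen → R} (h : IsHomogeneousCochain 𝒜 d k φ) (n : ℕ) :
    IsHomogeneousCochain 𝒜 d k ((A.step ^ n) φ) := by
  induction n with
  | zero => simpa using h
  | succ n ih =>
    rw [pow_succ', Module.End.mul_apply, step_apply]
    refine ih.sub ?_
    have := (IsHomogeneousCochain.homotopy ih).differential A
    rwa [add_sub_cancel_right] at this

theorem IsHomogeneousCochain.normalizer [GradedRing 𝒜] (A : MooreAlgebra 𝒜 d) {k : ℤ}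
    {φ : List MooreGen → MooreGen → R} (h : IsHomogeneousCochain 𝒜 d k φ) :
    IsHomogeneousCochain 𝒜 d (k + 1) (A.normalizer φ) := by
  intro w b
  rw [normalizer_apply]
  exact sum_mem fun n _ => (h.step_pow A n).homotopy w b

end MooreAlgebra

/-! ### Normalized cochains as power series -/

namespace MooreAlgebra

open MooreGen

variable {R : Type*} [CommRing R] {𝒜 : ℤ → AddSubgroup R} {d : ℤ}

/-- The normalized cochain `[y|…|y] ↦ fₙ [b]`. -/
noncomputable def ofSeries (b : MooreGen) : R⟦X⟧ →ₗ[R] List MooreGen → MooreGen → R where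
  toFun f w c := open Classical in
    if c = b then onPowers (fun n => PowerSeries.coeff n f) 0 w else 0
  map_add' f g := by
    funext w c
    by_cases h : c = b <;> by_cases hw : one ∈ w <;> simp [h, hw, onPowers]
  map_smul' r f := by
    funext w c
    by_cases h : c = b <;> by_cases hw : one ∈ w <;> simp [h, hw, onPowers]

theorem ofSeries_self (b : MooreGen) (f : R⟦X⟧) (w : List MooreGen) :
    ofSeries b f w b = onPowers (fun n => PowerSeries.coeff n f) 0 w := if_pos rfl

theorem ofSeries_of_ne {b c : MooreGen} (h : c ≠ b) (f : R⟦X⟧) (w : List MooreGen) :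
    ofSeries b f w c = 0 := if_neg h

theorem isNormalized_ofSeries (b : MooreGen) (f : R⟦X⟧) : IsNormalized (ofSeries b f) := by
  intro w c hw
  by_cases h : c = b
  · rw [h, ofSeries_self, onPowers, if_pos hw]
  · exact ofSeries_of_ne h f w

/-- The coefficients of `[b]` in the values of a cochain at the words `[y|…|y]`. -/
noncomputable def toSeries (b : MooreGen) : (List MooreGen → MooreGen → R) →ₗ[R] R⟦X⟧ where
  toFun φ := PowerSeries.mk fun n => φ (List.replicate n y) b
  map_add' φ ψ := by ext n; simp
  map_smul' r φ := by ext n; simp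

theorem coeff_toSeries (b : MooreGen) (φ : List MooreGen → MooreGen → R) (n : ℕ) :
    PowerSeries.coeff n (toSeries b φ) = φ (List.replicate n y) b :=
  PowerSeries.coeff_mk n fun n => φ (List.replicate n y) b

theorem toSeries_ofSeries (b : MooreGen) (f : R⟦X⟧) : toSeries b (ofSeries b f) = f := by
  ext n
  rw [coeff_toSeries, ofSeries_self, onPowers_replicate, add_zero]

theorem eq_of_isNormalized {φ ψ : List MooreGen → MooreGen → R} (hφ : IsNormalized φ)
    (hψ : IsNormalized ψ)
    (h : ∀ n b, φ (List.replicate n y) b = ψ (List.replicate n y) b) : φ = ψ := by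
  funext w b
  by_cases hw : one ∈ w
  · rw [hφ w b hw, hψ w b hw]
  · rw [eq_replicate hw, h]

/-- The N - i letters outside the factor of length i can be split between left and right in N - i +
1 ways. For k = 0 the coefficients are those of the derivative of u. -/
theorem outerPowers_replicate (u : ℕ → R) (g : List MooreGen → R) (k N : ℕ) :
    outerPowers u g k (List.replicate N y) = ∑ i ∈ Finset.range (N + 1),
      g (List.replicate i y) * (u (N - i + k + 1) * ((N - i : ℕ) + 1 : R)) := by
  induction N generalizing k with
  | zero => simp [outerPowers, mul_comm]
  | succ N ih =>
    rw [List.replicate_succ, outerPowers.eq_3, ih, ← List.replicate_succ, List.length_replicate,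
      Finset.sum_range_succ, Finset.sum_range_succ _ (N + 1), add_right_comm,
      ← Finset.sum_add_distrib]
    congr 1
    · refine Finset.sum_congr rfl fun i hi => ?_
      rw [Finset.mem_range] at hi
      have h1 : N + 1 - i = N - i + 1 := by omega
      rw [List.take_replicate, List.drop_replicate, onPowers_replicate, min_eq_left (by omega), h1]
      have h2 : N - i + 1 + (k + 1) = N - i + 1 + k + 1 := by omega
      have h3 : N - i + (k + 1) + 1 = N - i + 1 + k + 1 := by omega
      rw [h2, h3]
      push_cast
      ring
    · simp

/-- `curvature` and `contract` evaluate φ only at words with a letter [1], where it vanishes, and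
stripping y on the left or on the right of a power of y gives the same word. Only `outerPowers`
remains. -/
theorem differential_of_isNormalized (h𝒜 : IsEvenlyGraded 𝒜) (hd : Even d) (A : MooreAlgebra 𝒜 d)
    {φ : List MooreGen → MooreGen → R} (hφ : IsNormalized φ) : A.differential φ =
      ofSeries one (-(PowerSeries.derivative R A.charSeries * toSeries y φ)) := by
  have hφ' := isNormalized_iff.1 hφ
  refine eq_of_isNormalized ?_ (isNormalized_ofSeries _ _) ?_
  · rw [isNormalized_iff]
    intro c b
    exact vanishesBelow_differential h𝒜 hd A (hφ' c) b
  · intro n b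
    have hcurv : ∀ b, curvature A.u (fun v => φ v b) (List.replicate n y) = 0 := fun b =>
      curvature_eq_zero A.u_zero (hφ' _ b) (Nat.lt_succ_self _)
    have hcontr : ∀ b, contract (fun v => φ v b) (List.replicate n y) = 0 := fun b =>
      contract_eq_zero (hφ' _ b) (Nat.lt_succ_self _)
    cases b with
    | one =>
      have := congrFun (differential_one h𝒜 hd A φ) (List.replicate n y)
      simp only [Pi.sub_apply, Pi.mul_apply, hcurv, hcontr] at this
      rw [this, ofSeries_self, onPowers_replicate, map_neg,
        mul_comm (PowerSeries.derivative R A.charSeries), add_zero, outerPowers_replicate,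
        PowerSeries.coeff_mul, Finset.Nat.sum_antidiagonal_eq_sum_range_succ_mk]
      simp [wordSign, coeff_toSeries, coeff_charSeries, PowerSeries.coeff_derivative]
    | y =>
      have := congrFun (differential_y h𝒜 hd A φ) (List.replicate n y)
      simp only [Pi.sub_apply, Pi.add_apply, Pi.mul_apply, hcurv, hcontr] at this
      rw [this, ofSeries_of_ne (by simp)]
      cases n with
      | zero => simp
      | succ n =>
        have h1 : rightStrip [y] (fun v => φ v one) (List.replicate (n + 1) y) =
            φ (List.replicate n y) one := by
          rw [List.replicate_succ', rightStrip_append]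
        have h2 : leftStrip [y] (fun v => φ v one) (List.replicate (n + 1) y) =
            φ (List.replicate n y) one := by
          rw [List.replicate_succ, leftStrip_singleton_cons, if_pos rfl]
        rw [h1, h2]
        simp

theorem isHomogeneousCochain_ofSeries {k : ℤ} {b : MooreGen} {f : R⟦X⟧}
    (h : GradedSeries.IsHomogeneous 𝒜 d (k - (MooreGen.deg d b + 1)) f) :
    IsHomogeneousCochain 𝒜 d k (ofSeries b f) := by
  intro w c
  by_cases hw : one ∈ w
  · rw [isNormalized_ofSeries b f w c hw]
    exact zero_mem _
  · rw [eq_replicate hw]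
    by_cases hc : c = b
    · subst hc
      rw [ofSeries_self, onPowers_replicate, wordDeg_replicate, add_zero]
      convert h w.length using 2
      ring
    · rw [ofSeries_of_ne hc]
      exact zero_mem _

theorem IsHomogeneousCochain.toSeries {k : ℤ} {φ : List MooreGen → MooreGen → R}
    (h : IsHomogeneousCochain 𝒜 d k φ) (b : MooreGen) :
    GradedSeries.IsHomogeneous 𝒜 d (k - (MooreGen.deg d b + 1)) (toSeries b φ) := by
  intro n
  rw [coeff_toSeries]
  convert h (List.replicate n y) b using 2
  rw [wordDeg_replicate]
  ring

/-- The coderivation `[y|…|y] ↦ fₙ [b]`. -/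
noncomputable def seriesCoder (d : ℤ) (b : MooreGen) : R⟦X⟧ →ₗ[R] Module.End R (T R MooreGen) :=
  cofree (MooreGen.deg d) ∘ₗ ofSeries b

theorem seriesCoder_mem_coder (b : MooreGen) (f : R⟦X⟧) :
    seriesCoder d b f ∈ coder (MooreGen.deg d) := cofree_mem_coder _ _

theorem component_seriesCoder (b : MooreGen) (f : R⟦X⟧) :
    component (seriesCoder d b f) = ofSeries b f := component_cofree _ _

/-- `normalizer` on coderivations. -/
noncomputable def coderNormalizer (A : MooreAlgebra 𝒜 d) :
    Module.End R (T R MooreGen) →ₗ[R] Module.End R (T R MooreGen) :=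
  cofree (MooreGen.deg d) ∘ₗ A.normalizer ∘ₗ components

theorem component_coderNormalizer (A : MooreAlgebra 𝒜 d) (ξ : Module.End R (T R MooreGen)) :
    component (A.coderNormalizer ξ) = A.normalizer (component ξ) := component_cofree _ _

theorem coderNormalizer_mem_coder (A : MooreAlgebra 𝒜 d) (ξ : Module.End R (T R MooreGen)) :
    A.coderNormalizer ξ ∈ coder (MooreGen.deg d) := cofree_mem_coder _ _

theorem hochschildD_seriesCoder (h𝒜 : IsEvenlyGraded 𝒜) (hd : Even d) (A : MooreAlgebra 𝒜 d)
    (b : MooreGen) (f : R⟦X⟧) : A.hochschildD (seriesCoder d b f) =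
      seriesCoder d one (-(PowerSeries.derivative R A.charSeries * toSeries y (ofSeries b f))) := by
  refine eq_of_component_eq (A.hochschildD_mem_coder h𝒜 (seriesCoder_mem_coder _ _))
    (seriesCoder_mem_coder _ _) ?_
  rw [← differential_component _ (seriesCoder_mem_coder _ _), component_seriesCoder,
    component_seriesCoder, differential_of_isNormalized h𝒜 hd A (isNormalized_ofSeries b f)]

theorem toSeries_y_ofSeries_one (f : R⟦X⟧) : toSeries y (ofSeries one f) = 0 := by
  ext n
  rw [coeff_toSeries, ofSeries_of_ne (by simp), map_zero]

theorem hochschildD_seriesCoder_one (h𝒜 : IsEvenlyGraded 𝒜) (hd : Even d) (A : MooreAlgebra 𝒜 d)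
    (f : R⟦X⟧) : A.hochschildD (seriesCoder d one f) = 0 := by
  rw [hochschildD_seriesCoder h𝒜 hd, toSeries_y_ofSeries_one, mul_zero, neg_zero, map_zero]

theorem hochschildD_seriesCoder_y (h𝒜 : IsEvenlyGraded 𝒜) (hd : Even d) (A : MooreAlgebra 𝒜 d)
    (g : R⟦X⟧) : A.hochschildD (seriesCoder d y g) =
      seriesCoder d one (-(PowerSeries.derivative R A.charSeries * g)) := by
  rw [hochschildD_seriesCoder h𝒜 hd, toSeries_ofSeries]

/-- The normalized representative modulo coboundaries of a coderivation. -/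
noncomputable def normalize (A : MooreAlgebra 𝒜 d) (ξ : Module.End R (T R MooreGen)) :
    Module.End R (T R MooreGen) := ξ - A.hochschildD (A.coderNormalizer ξ)

theorem normalize_mem_coder (h𝒜 : IsEvenlyGraded 𝒜) (A : MooreAlgebra 𝒜 d)
    {ξ : Module.End R (T R MooreGen)} (hξ : ξ ∈ coder (MooreGen.deg d)) :
    A.normalize ξ ∈ coder (MooreGen.deg d) :=
  sub_mem hξ (A.hochschildD_mem_coder h𝒜 (A.coderNormalizer_mem_coder ξ))

theorem hochschildD_normalize (h𝒜 : IsEvenlyGraded 𝒜) (A : MooreAlgebra 𝒜 d)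
    (ξ : Module.End R (T R MooreGen)) : A.hochschildD (A.normalize ξ) = A.hochschildD ξ := by
  rw [normalize, map_sub, A.hochschildD_hochschildD h𝒜, sub_zero]

theorem isNormalized_normalize (h𝒜 : IsEvenlyGraded 𝒜) (hd : Even d) (A : MooreAlgebra 𝒜 d)
    {ξ : Module.End R (T R MooreGen)} (hξ : ξ ∈ coder (MooreGen.deg d))
    (h : IsNormalized (component (A.hochschildD ξ))) :
    IsNormalized (component (A.normalize ξ)) := by
  rw [← differential_component A hξ] at h
  have := isNormalized_sub_normalizer h𝒜 hd A h
  rwa [← component_coderNormalizer, differential_component A (A.coderNormalizer_mem_coder ξ),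
    ← components_apply, ← components_apply, ← map_sub] at this

/-- If the coboundary of a coderivation is given by a power series, the series is a multiple of the
derivative of the characteristic series. -/
theorem series_eq_of_hochschildD_eq (h𝒜 : IsEvenlyGraded 𝒜) (hd : Even d) (A : MooreAlgebra 𝒜 d)
    {ξ : Module.End R (T R MooreGen)} (hξ : ξ ∈ coder (MooreGen.deg d)) {f : R⟦X⟧}
    (h : A.hochschildD ξ = seriesCoder d one f) :
    f = -(PowerSeries.derivative R A.charSeries * toSeries y (component (A.normalize ξ))) := by
  -- Here ξ need not be a cocycle: its coboundary is given by a series, hence normalized, and this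
  -- is all that normalization requires.
  have hn : IsNormalized (component (A.normalize ξ)) := by
    refine isNormalized_normalize h𝒜 hd A hξ ?_
    rw [h, component_seriesCoder]
    exact isNormalized_ofSeries _ _
  have h1 := differential_of_isNormalized h𝒜 hd A hn
  rw [differential_component A (normalize_mem_coder h𝒜 A hξ), hochschildD_normalize h𝒜, h,
    component_seriesCoder] at h1
  rw [← toSeries_ofSeries one f, h1, toSeries_ofSeries]

/-- The constant coefficient of u' is u₁, and a power series whose constant coefficient is not a
zero divisor is not a zero divisor. -/
theorem derivative_mul_eq_zero {A : MooreAlgebra 𝒜 d}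
    (hu : PowerSeries.coeff 1 A.charSeries ∈ nonZeroDivisors R) {g : R⟦X⟧}
    (h : PowerSeries.derivative R A.charSeries * g = 0) : g = 0 := by
  have h1 : PowerSeries.derivative R A.charSeries ∈ nonZeroDivisors R⟦X⟧ := by
    refine MvPowerSeries.mem_nonZeroDivisors_of_constantCoeff ?_
    change PowerSeries.constantCoeff _ ∈ _
    rw [← PowerSeries.coeff_zero_eq_constantCoeff_apply, PowerSeries.coeff_derivative]
    simpa using hu
  exact (mul_left_mem_nonZeroDivisors_eq_zero_iff h1).1 h

/-- Every cocycle is cohomologous to the one given by a power series. -/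
theorem normalize_eq_seriesCoder (h𝒜 : IsEvenlyGraded 𝒜) (hd : Even d) (A : MooreAlgebra 𝒜 d)
    (hu : PowerSeries.coeff 1 A.charSeries ∈ nonZeroDivisors R)
    {ξ : Module.End R (T R MooreGen)} (hξ : ξ ∈ coder (MooreGen.deg d))
    (h : A.hochschildD ξ = 0) :
    A.normalize ξ = seriesCoder d one (toSeries one (component (A.normalize ξ))) := by
  -- For a cocycle the coboundary is the series 0, so u' annihilates the series of the output [y].
  have hg : toSeries y (component (A.normalize ξ)) = 0 := by
    have := series_eq_of_hochschildD_eq h𝒜 hd A hξ (f := 0) (by rw [h, map_zero])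
    exact derivative_mul_eq_zero hu (neg_eq_zero.1 this.symm)
  have hn : IsNormalized (component (A.normalize ξ)) := by
    refine isNormalized_normalize h𝒜 hd A hξ ?_
    rw [h, ← components_apply, map_zero]
    exact fun _ _ _ => rfl
  refine eq_of_component_eq (normalize_mem_coder h𝒜 A hξ) (seriesCoder_mem_coder _ _) ?_
  rw [component_seriesCoder]
  refine eq_of_isNormalized hn (isNormalized_ofSeries _ _) fun n b => ?_
  cases b with
  | one => rw [ofSeries_self, onPowers_replicate, coeff_toSeries, add_zero]
  | y =>
    rw [← coeff_toSeries y (component (A.normalize ξ)) n, hg, ofSeries_of_ne (by simp), map_zero]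

/-! ### Comparison of the cohomology with the quotient by u' -/

/-- A complex `C` of coderivations and a module `S` of power series that correspond to each
other. -/
structure Compatible (A : MooreAlgebra 𝒜 d) (C : Submodule R (Module.End R (T R MooreGen)))
    (S : Submodule R R⟦X⟧) : Prop where
  le_coder : C ≤ coder (MooreGen.deg d)
  hochschildD_mem : ∀ ξ ∈ C, A.hochschildD ξ ∈ C
  coderNormalizer_mem : ∀ ξ ∈ C, A.coderNormalizer ξ ∈ C
  seriesCoder_mem : ∀ b, ∀ f ∈ S, seriesCoder d b f ∈ C
  toSeries_mem : ∀ b, ∀ ξ ∈ C, toSeries b (component ξ) ∈ S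

namespace Compatible

variable {A : MooreAlgebra 𝒜 d} {C : Submodule R (Module.End R (T R MooreGen))}
  {S : Submodule R R⟦X⟧}

theorem normalize_mem (h : A.Compatible C S) {ξ : Module.End R (T R MooreGen)} (hξ : ξ ∈ C) :
    A.normalize ξ ∈ C :=
  sub_mem hξ (h.hochschildD_mem _ (h.coderNormalizer_mem _ hξ))

/-- The cocycle `[y|…|y] ↦ fₙ [1]`. -/
noncomputable def toCocycles (h : A.Compatible C S) (h𝒜 : IsEvenlyGraded 𝒜) (hd : Even d) :
    S →ₗ[R] A.cocycles C :=
  LinearMap.codRestrict (A.cocycles C) (seriesCoder d one ∘ₗ S.subtype) fun f =>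
    ⟨h.seriesCoder_mem one f f.2, hochschildD_seriesCoder_one h𝒜 hd A f⟩

/-- The class of the cocycle `[y|…|y] ↦ fₙ [1]`. -/
noncomputable def toCohomology (h : A.Compatible C S) (h𝒜 : IsEvenlyGraded 𝒜) (hd : Even d) :
    S →ₗ[R] A.Cohomology C :=
  Submodule.mkQ _ ∘ₗ h.toCocycles h𝒜 hd

theorem coe_toCocycles (h : A.Compatible C S) (h𝒜 : IsEvenlyGraded 𝒜) (hd : Even d) (f : S) :
    (h.toCocycles h𝒜 hd f : Module.End R (T R MooreGen)) = seriesCoder d one f := rfl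

theorem mem_ker_toCohomology (h : A.Compatible C S) (h𝒜 : IsEvenlyGraded 𝒜) (hd : Even d)
    (f : S) : f ∈ LinearMap.ker (h.toCohomology h𝒜 hd) ↔
      ∃ g ∈ S, PowerSeries.derivative R A.charSeries * g = f := by
  rw [LinearMap.mem_ker, toCohomology, LinearMap.comp_apply, Submodule.mkQ_apply,
    Submodule.Quotient.mk_eq_zero, Submodule.submoduleOf,
    Submodule.mem_comap, Submodule.subtype_apply, coe_toCocycles, Submodule.mem_map]
  constructor
  · rintro ⟨ξ, hξ, e⟩
    -- An arbitrary ξ may bound the cocycle; its normalization has the same coboundary and supplies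
    -- the factor.
    refine ⟨-toSeries y (component (A.normalize ξ)),
      neg_mem (h.toSeries_mem _ _ (h.normalize_mem hξ)), ?_⟩
    rw [series_eq_of_hochschildD_eq h𝒜 hd A (h.le_coder hξ) e, mul_neg]
  · rintro ⟨g, hg, e⟩
    refine ⟨seriesCoder d y (-g), h.seriesCoder_mem _ _ (neg_mem hg), ?_⟩
    rw [hochschildD_seriesCoder_y h𝒜 hd, mul_neg, neg_neg, e]

/-- The power series that represents the class of a cocycle. -/
noncomputable def series (h : A.Compatible C S) (z : A.cocycles C) : S :=
  ⟨toSeries one (component (A.normalize z)), h.toSeries_mem _ _ (h.normalize_mem z.2.1)⟩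

/-- A cocycle differs from its normalization by the coboundary of `coderNormalizer`, which stays in
`C`. -/
theorem toCohomology_series (h : A.Compatible C S) (h𝒜 : IsEvenlyGraded 𝒜) (hd : Even d)
    (hu : PowerSeries.coeff 1 A.charSeries ∈ nonZeroDivisors R) (z : A.cocycles C) :
    h.toCohomology h𝒜 hd (h.series z) = Submodule.Quotient.mk z := by
  rw [toCohomology, LinearMap.comp_apply, Submodule.mkQ_apply, eq_comm, Submodule.Quotient.eq,
    Submodule.submoduleOf,
    Submodule.mem_comap, Submodule.subtype_apply, Submodule.coe_sub, coe_toCocycles, series,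
    ← normalize_eq_seriesCoder h𝒜 hd A hu (h.le_coder z.2.1) (LinearMap.mem_ker.1 z.2.2), normalize,
    sub_sub_cancel]
  exact Submodule.mem_map_of_mem (h.coderNormalizer_mem _ z.2.1)

theorem toCohomology_surjective (h : A.Compatible C S) (h𝒜 : IsEvenlyGraded 𝒜) (hd : Even d)
    (hu : PowerSeries.coeff 1 A.charSeries ∈ nonZeroDivisors R) :
    Function.Surjective (h.toCohomology h𝒜 hd) := by
  intro x
  obtain ⟨z, rfl⟩ := Submodule.Quotient.mk_surjective _ x
  exact ⟨_, h.toCohomology_series h𝒜 hd hu z⟩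

/-- The homotopies raise the degree by 1 and the differential lowers it by 1, so normalization keeps
the degree k; reading off the coefficient of [1] subtracts its degree 1. -/
theorem isHomogeneous_series [GradedRing 𝒜] (h : A.Compatible C S) {z : A.cocycles C} {k : ℤ}
    (hz : IsHomogeneous 𝒜 (MooreGen.deg d) k (z : Module.End R (T R MooreGen))) :
    GradedSeries.IsHomogeneous 𝒜 d (k - 1) (h.series z : R⟦X⟧) := by
  have h1 : IsHomogeneous 𝒜 (MooreGen.deg d) (k + 1) (A.coderNormalizer z) :=
    isHomogeneous_cofree
      (IsHomogeneousCochain.normalizer A (φ := component _) fun w b => hz.component_mem w b)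
  have h2 := A.isHomogeneous_hochschildD h1
  rw [add_sub_cancel_right] at h2
  have h3 : IsHomogeneousCochain 𝒜 d k (component (A.normalize z)) :=
    fun w b => (hz.sub h2).component_mem w b
  have h4 := h3.toSeries one
  rwa [show k - (MooreGen.deg d one + 1) = k - 1 by simp [MooreGen.deg]] at h4

/-- The cohomology of `C` is the quotient of `S` by the multiples of the derivative of the
characteristic series. -/
theorem exists_equiv [GradedRing 𝒜] (h : A.Compatible C S) (h𝒜 : IsEvenlyGraded 𝒜) (hd : Even d)
    (hu : PowerSeries.coeff 1 A.charSeries ∈ nonZeroDivisors R) {Q : Type*} [AddCommGroup Q]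
    [Module R Q] (q : S →ₗ[R] Q) (hq : Function.Surjective q)
    (hker : ∀ f : S, q f = 0 ↔ ∃ g ∈ S, PowerSeries.derivative R A.charSeries * g = f) :
    ∃ e : A.Cohomology C ≃ₗ[R] Q, ∀ k : ℤ, e '' A.cohomologyDeg C k =
      {x | ∃ f : S, GradedSeries.IsHomogeneous 𝒜 d (k - 1) (f : R⟦X⟧) ∧ q f = x} := by
  have hk : LinearMap.ker (h.toCohomology h𝒜 hd) = LinearMap.ker q := by
    ext f
    rw [h.mem_ker_toCohomology h𝒜 hd, LinearMap.mem_ker, hker]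
  -- Both sides are quotients of `S` by the same kernel.
  let e : A.Cohomology C ≃ₗ[R] Q :=
    ((h.toCohomology h𝒜 hd).quotKerEquivOfSurjective (h.toCohomology_surjective h𝒜 hd hu)).symm ≪≫ₗ
      Submodule.quotEquivOfEq _ _ hk ≪≫ₗ q.quotKerEquivOfSurjective hq
  have he : ∀ f, e (h.toCohomology h𝒜 hd f) = q f := by
    intro f
    have h1 : ((h.toCohomology h𝒜 hd).quotKerEquivOfSurjective
        (h.toCohomology_surjective h𝒜 hd hu)).symm (h.toCohomology h𝒜 hd f) =
        Submodule.Quotient.mk f := by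
      rw [LinearEquiv.symm_apply_eq]
      rfl
    simp only [e, LinearEquiv.trans_apply, h1]
    rfl
  refine ⟨e, fun k => Set.ext fun x => ⟨?_, ?_⟩⟩
  · rintro ⟨_, ⟨z, hz, rfl⟩, rfl⟩
    refine ⟨h.series z, h.isHomogeneous_series hz, ?_⟩
    rw [← he, h.toCohomology_series h𝒜 hd hu]
  · rintro ⟨f, hf, rfl⟩
    refine ⟨h.toCohomology h𝒜 hd f, ⟨h.toCocycles h𝒜 hd f, ?_, rfl⟩, he f⟩
    rw [coe_toCocycles]
    refine isHomogeneous_cofree (isHomogeneousCochain_ofSeries ?_)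
    rwa [show k - (MooreGen.deg d one + 1) = k - 1 by simp [MooreGen.deg]]

end Compatible

theorem compatible_coder (h𝒜 : IsEvenlyGraded 𝒜) (A : MooreAlgebra 𝒜 d) :
    A.Compatible (coder (MooreGen.deg d)) ⊤ where
  le_coder := le_rfl
  hochschildD_mem _ hξ := A.hochschildD_mem_coder h𝒜 hξ
  coderNormalizer_mem _ _ := A.coderNormalizer_mem_coder _
  seriesCoder_mem _ _ _ := seriesCoder_mem_coder _ _
  toSeries_mem _ _ _ := Submodule.mem_top

theorem map_mem_span {M N : Type*} [AddCommGroup M] [AddCommGroup N] [Module R M] [Module R N]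
    (Φ : M →ₗ[R] N) {s : Set M} {t : Set N} (h : ∀ x ∈ s, Φ x ∈ t) {x : M}
    (hx : x ∈ Submodule.span R s) : Φ x ∈ Submodule.span R t :=
  (Submodule.span_le (p := (Submodule.span R t).comap Φ)).2
    (fun x hx => Submodule.subset_span (h x hx)) hx

/-- All maps involved are linear and send homogeneous elements to homogeneous ones, so each
condition can be checked on the homogeneous generators of the spans. -/
theorem compatible_gradedCoder [GradedRing 𝒜] (h𝒜 : IsEvenlyGraded 𝒜) (A : MooreAlgebra 𝒜 d) :
    A.Compatible (gradedCoder 𝒜 (MooreGen.deg d)) (GradedSeries.ring 𝒜 d) where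
  le_coder := Submodule.span_le.2 fun _ h => h.1
  hochschildD_mem ξ hξ := by
    refine map_mem_span A.hochschildD ?_ hξ
    rintro _ ⟨h, _, hk⟩
    exact ⟨A.hochschildD_mem_coder h𝒜 h, _, A.isHomogeneous_hochschildD hk⟩
  coderNormalizer_mem ξ hξ := by
    refine map_mem_span A.coderNormalizer ?_ hξ
    rintro η ⟨-, _, hk⟩
    exact ⟨A.coderNormalizer_mem_coder _, _, isHomogeneous_cofree
      (IsHomogeneousCochain.normalizer A (φ := component η) fun w b => hk.component_mem w b)⟩
  seriesCoder_mem b f hf := by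
    refine map_mem_span (seriesCoder d b) ?_ hf
    rintro _ ⟨k, hk⟩
    exact ⟨seriesCoder_mem_coder _ _, k + (MooreGen.deg d b + 1), isHomogeneous_cofree
      (isHomogeneousCochain_ofSeries (by rwa [add_sub_cancel_right]))⟩
  toSeries_mem b ξ hξ := by
    refine map_mem_span (toSeries b ∘ₗ components) ?_ hξ
    rintro η ⟨-, _, hk⟩
    exact ⟨_, IsHomogeneousCochain.toSeries (φ := component η)
      (fun w b => hk.component_mem w b) b⟩

end MooreAlgebra

theorem mainTheorem4 {R : Type*} [CommRing R] (𝒜 : ℤ → AddSubgroup R) [GradedRing 𝒜]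
    (h𝒜 : IsEvenlyGraded 𝒜) (d : ℤ) (hd : Even d) (A : MooreAlgebra 𝒜 d)
    (hu : PowerSeries.coeff 1 A.charSeries ∈ nonZeroDivisors R) :
    (∃ e : A.HH ≃ₗ[R] GradedSeries.Quot 𝒜 d (PowerSeries.derivative R A.charSeries),
      ∀ k : ℤ, e '' A.cohomologyDeg (gradedCoder 𝒜 (MooreGen.deg d)) k =
        GradedSeries.quotDeg 𝒜 d (PowerSeries.derivative R A.charSeries) (k - 1)) ∧
    (∃ e : A.HHTot ≃ₗ[R] R⟦X⟧ ⧸ Ideal.span {PowerSeries.derivative R A.charSeries},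
      ∀ k : ℤ, e '' A.cohomologyDeg (coder (MooreGen.deg d)) k =
        {x | ∃ f : R⟦X⟧, GradedSeries.IsHomogeneous 𝒜 d (k - 1) f ∧
          Submodule.Quotient.mk f = x}) := by
  constructor
  · refine (MooreAlgebra.compatible_gradedCoder h𝒜 A).exists_equiv h𝒜 hd hu
      (Submodule.mkQ (((GradedSeries.ring 𝒜 d).map (LinearMap.mulLeft R
        (PowerSeries.derivative R A.charSeries))).submoduleOf (GradedSeries.ring 𝒜 d)))
      (Submodule.mkQ_surjective _) fun f => ?_
    rw [Submodule.mkQ_apply, Submodule.Quotient.mk_eq_zero, Submodule.submoduleOf,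
    Submodule.mem_comap, Submodule.subtype_apply,
      Submodule.mem_map]
    rfl
  · obtain ⟨e, he⟩ := (MooreAlgebra.compatible_coder h𝒜 A).exists_equiv h𝒜 hd hu
      ((Ideal.Quotient.mkₐ R (Ideal.span {PowerSeries.derivative R A.charSeries})).toLinearMap ∘ₗ
        (⊤ : Submodule R R⟦X⟧).subtype)
      (fun x => by
        obtain ⟨f, rfl⟩ := Ideal.Quotient.mk_surjective x
        exact ⟨⟨f, Submodule.mem_top⟩, rfl⟩)
      (fun f => by
        change Ideal.Quotient.mk _ (f : R⟦X⟧) = 0 ↔ _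
        rw [Ideal.Quotient.eq_zero_iff_mem, Ideal.mem_span_singleton']
        simp [mul_comm])
    refine ⟨e, fun k => (he k).trans (Set.ext fun x => ⟨?_, ?_⟩)⟩
    · rintro ⟨f, hf, rfl⟩
      exact ⟨f, hf, rfl⟩
    · rintro ⟨f, hf, rfl⟩
      exact ⟨⟨f, Submodule.mem_top⟩, hf, rfl⟩
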